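/- Let $G$ be an amenable locally compact (Hausdorff) group with a left Haar measure $\lambda$, let $(\Omega,\mu)$ be a measure space, let $1\le p<\infty$, and let all $L^p$-spaces be complex. For $k\in L^1(G,\lambda)$ let $\lambda_p(k)\in B(L^p(G,\lambda))$ be the convolution operator $$(\lambda_p(k)g)(x)=\int_G k(y)\,g(y^{-1}x)\,d\lambda(y)\qquad(\text{for almost every }x\in G),$$ which is well defined. Let $\pi:G\to B(L^p(\Omega,\mu))$ be a uniformly bounded, strongly continuous representation of $G$, that is, a group homomorphism into the invertible operators such that $x\mapsto\pi(x)f$ is continuous for every $f\in L^p(\Omega,\mu)$ and $\sup_{x\in G}\|\pi(x)\|<\infty$. For a Banach space $E$ and an $n\times n$ matrix $(m_{ij})$ with entries in $B(E)$ put $$\|(m_{ij})\|_{(n)}=\sup\Big\{\Big(\sum_{i=1}^n\Big\|\sum_{j=1}^n m_{ij}g_j\Big\|^p\Big)^{1/p}\;:\;g_1,\dots,g_n\in E,\ \Big(\sum_{j=1}^n\|g_j\|^p\Big)^{1/p}\le 1\Big\}.$$ A linear map $u:S\to B(F)$ on a linear subspace $S\subseteq B(E)$ is called $p$-completely bounded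 if there is a finite constant $C$ such that $\|(u(m_{ij}))\|_{(n)}\le C\,\|(m_{ij})\|_{(n)}$ for all $n$ and all $n\times n$ matrices $(m_{ij})$ with entries in $S$; the least such $C\ge 0$ is its $p$-completely bounded norm $\|u\|_{p\text{-}cb}$. Then $\lambda_p(L^1(G,\lambda))$ is a subalgebra of $B(L^p(G,\lambda))$, and there is a well-defined linear map $$\lambda_\pi:\lambda_p(L^1(G,\lambda))\to B(L^p(\Omega,\mu)),\qquad \lambda_\pi(\lambda_p(k))f=\int_G k(x)\,\pi(x)f\,d\lambda(x)\quad(k\in L^1(G,\lambda),\ f\in L^p(\Omega,\mu)),$$ which is a $p$-completely bounded algebra homomorphism with $$\|\lambda_\pi\|_{p\text{-}cb}\le\Big(\sup_{x\in G}\|\pi(x)\|\Big)^2 .$$ -/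

import Mathlib

open MeasureTheory MeasureTheory.Measure
open scoped ENNReal BoundedContinuousFunction

/-- A topological group `G` is amenable: there is a left invariant mean on the space of bounded
continuous real functions on `G`, i.e. a positive, normalised, linear functional which is invariant
under the left translations `f ↦ f(x ·)`. -/
def IsAmenableGroup (G : Type*) [TopologicalSpace G] [Group G] [IsTopologicalGroup G] : Prop :=
  ∃ M : (G →ᵇ ℝ) →ₗ[ℝ] ℝ,
    (∀ f : G →ᵇ ℝ, (∀ y, 0 ≤ f y) → 0 ≤ M f) ∧
    M (BoundedContinuousFunction.const G 1) = 1 ∧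
    ∀ (x : G) (f : G →ᵇ ℝ),
      M (f.compContinuous ⟨fun y => x * y, continuous_const_mul x⟩) = M f

/-- `T` is the operator of left convolution by `k` on `L^p(G, ν)`: for every `g` and for almost
every `x`, the integral of `y ↦ k(y) g(y⁻¹ x)` converges absolutely and its value is
`(T g)(x)`. -/
def IsConvolutionOperator {G : Type*} [Group G] [MeasurableSpace G] (ν : Measure G) (p : ℝ≥0∞)
    [Fact (1 ≤ p)] (k : G → ℂ) (T : Lp ℂ p ν →L[ℂ] Lp ℂ p ν) : Prop :=
  ∀ g : Lp ℂ p ν, ∀ᵐ x ∂ν,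
    Integrable (fun y => k y * g (y⁻¹ * x)) ν ∧ T g x = ∫ y, k y * g (y⁻¹ * x) ∂ν

/-- The subspace `λ_p(L¹(G, ν))` of `B(L^p(G, ν))`: all operators of left convolution by an
integrable function. -/
def convolutionOperators {G : Type*} [Group G] [MeasurableSpace G] (ν : Measure G) (p : ℝ≥0∞)
    [Fact (1 ≤ p)] : Submodule ℂ (Lp ℂ p ν →L[ℂ] Lp ℂ p ν) where
  carrier := {T | ∃ k : G → ℂ, Integrable k ν ∧ IsConvolutionOperator ν p k T}
  zero_mem' := by
    refine ⟨0, integrable_zero _ _ _, fun g => ?_⟩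
    filter_upwards [Lp.coeFn_zero ℂ p ν] with x hx
    have h : (0 : Lp ℂ p ν →L[ℂ] Lp ℂ p ν) g x = 0 := hx
    exact ⟨by simp, h.trans (by simp)⟩
  add_mem' := by
    rintro S T ⟨k, hk, hS⟩ ⟨l, hl, hT⟩
    refine ⟨k + l, hk.add hl, fun g => ?_⟩
    filter_upwards [hS g, hT g, Lp.coeFn_add (S g) (T g)] with x h1 h2 h3
    have e : (fun y => (k + l) y * g (y⁻¹ * x)) =
        fun y => k y * g (y⁻¹ * x) + l y * g (y⁻¹ * x) := by
      funext y
      simp [add_mul]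
    rw [e]
    refine ⟨h1.1.add h2.1, ?_⟩
    rw [integral_add h1.1 h2.1, ← h1.2, ← h2.2]
    exact h3
  smul_mem' := by
    rintro c T ⟨k, hk, hT⟩
    refine ⟨c • k, hk.smul c, fun g => ?_⟩
    filter_upwards [hT g, Lp.coeFn_smul c (T g)] with x h1 h2
    have e : (fun y => (c • k) y * g (y⁻¹ * x)) = fun y => c * (k y * g (y⁻¹ * x)) := by
      funext y
      simp [mul_assoc]
    rw [e]
    refine ⟨h1.1.const_mul c, ?_⟩
    rw [integral_const_mul, ← h1.2]
    exact h2

/-- The norm `‖(m_{ij})‖_{(n)}` of an `n × n` matrix of bounded operators on `E`, i.e. the supremum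
of `(∑ i, ‖∑ j, m_{ij} g_j‖^p)^(1/p)` over all `g_1, …, g_n` in `E` with
`(∑ j, ‖g_j‖^p)^(1/p) ≤ 1`. -/
noncomputable def matrixNorm (p : ℝ≥0∞) {E : Type*} [NormedAddCommGroup E] [NormedSpace ℂ E]
    {n : ℕ} (m : Matrix (Fin n) (Fin n) (E →L[ℂ] E)) : ℝ :=
  sSup {r : ℝ | ∃ g : Fin n → E, (∑ j, ‖g j‖ ^ p.toReal) ^ (1 / p.toReal) ≤ 1 ∧
    r = (∑ i, ‖∑ j, m i j (g j)‖ ^ p.toReal) ^ (1 / p.toReal)}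

/-- `C` is a constant of `p`-complete boundedness of the linear map `u : S → B(F)`, where
`S ⊆ B(E)` is a subspace: `‖(u(m_{ij}))‖_{(n)} ≤ C ‖(m_{ij})‖_{(n)}` for all `n` and all `n × n`
matrices with entries in `S`. -/
def PCompletelyBoundedBy (p : ℝ≥0∞) {E F : Type*} [NormedAddCommGroup E] [NormedSpace ℂ E]
    [NormedAddCommGroup F] [NormedSpace ℂ F] {S : Submodule ℂ (E →L[ℂ] E)}
    (u : S →ₗ[ℂ] (F →L[ℂ] F)) (C : ℝ) : Prop :=
  ∀ (n : ℕ) (m : Matrix (Fin n) (Fin n) S),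
    matrixNorm p (m.map fun a => u a) ≤ C * matrixNorm p (m.map fun a => (a : E →L[ℂ] E))

/-- `u` is `p`-completely bounded. -/
def IsPCompletelyBounded (p : ℝ≥0∞) {E F : Type*} [NormedAddCommGroup E] [NormedSpace ℂ E]
    [NormedAddCommGroup F] [NormedSpace ℂ F] {S : Submodule ℂ (E →L[ℂ] E)}
    (u : S →ₗ[ℂ] (F →L[ℂ] F)) : Prop :=
  ∃ C : ℝ, 0 < C ∧ PCompletelyBoundedBy p u C

/-- The `p`-completely bounded norm of `u`: the least constant `C ≥ 0` of `p`-complete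
boundedness. (To be used together with `IsPCompletelyBounded p u`.) -/
noncomputable def pcbNorm (p : ℝ≥0∞) {E F : Type*} [NormedAddCommGroup E] [NormedSpace ℂ E]
    [NormedAddCommGroup F] [NormedSpace ℂ F] {S : Submodule ℂ (E →L[ℂ] E)}
    (u : S →ₗ[ℂ] (F →L[ℂ] F)) : ℝ :=
  sInf {C : ℝ | 0 ≤ C ∧ PCompletelyBoundedBy p u C}

/-!
Transference for an amenable group `G`. Write `λ` for the left regular representation, `π(k)` and
`λ(k)` for the integrated forms `∫ k(x) π(x) dx` and `∫ k(x) λ(x) dx`, `B` for the supremum of the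
norms `‖π(x)‖`, and `E = L^p(Ω)`.

*The regular representation.* Convolution by `k` on `L^p(G)` is the integrated form `λ(k)`
(`isConvolutionOperator_integratedForm`). Haar measure is not assumed to be `σ`-finite, nor `G` to be
second countable, so Fubini's theorem is used only for compactly supported continuous functions; the
general case is a dominated limit along rapid approximations.

*Almost invariant vectors.* Amenability gives unit vectors `ψ` in `L^p(G)` with `‖λ(y) ψ - ψ‖` small
uniformly for `y` in a compact set (`exists_reiter_Lp`). By uniqueness of Haar measure an invariant
mean sees only the integral of a weight with which a function is averaged, so Day's convexity argument
yields probability densities almost invariant under finitely many averages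
(`exists_norm_integratedForm_sub_lt`); one further average makes this uniform on compact sets, and
`p`-th roots lead from `L¹` to `L^p`.

*Transference.* Send `f` in `E` to the function `x ↦ ψ(x) π(x⁻¹) f` in `L^p(G; E)` (`orbitMap`). This
multiplies norms by a factor between `1 / B` and `B`, and it intertwines `π(k)` with convolution by
`k` on `L^p(G; E)` up to an error governed by `∫ |k(y)| ‖λ(y) ψ - ψ‖ dy`, which is arbitrarily small
(`norm_integratedForm_orbitMap_sub_le`). A matrix of operators on `L^p(G)` gains no norm when it is
tensored with the identity of `E`, because `E` is itself an `L^p`-space (`amplification_le`). Together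
these bound a matrix of operators `π(k_{ij})` by `B ^ 2` times the norm of the matrix of convolution
operators (`sum_norm_integratedForm_rpow_le`). The case of `1 × 1` matrices shows that `π(k)` depends
only on the operator of convolution by `k`, which makes the homomorphism well defined; it is
multiplicative because integrated forms take the convolution product of `L¹(G)` to composition
(`integratedForm_convolution`).
-/

set_option linter.unusedSectionVars false

open Filter Topology

/-! ### Approximation by compactly supported continuous functions -/

section Approximation

variable {X E : Type*} [TopologicalSpace X] [RegularSpace X] [LocallyCompactSpace X]
  [MeasurableSpace X] [BorelSpace X] [NormedAddCommGroup E] [NormedSpace ℝ E]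
  {μ : Measure X} [Regular μ] {p : ℝ≥0∞}

open Set in
/-- Density of the compactly supported continuous functions in `L^p`, for `p < ∞`. The space is only
assumed to be regular: locally compact groups need not be known to be normal. -/
theorem MeasureTheory.MemLp.exists_hasCompactSupport_eLpNorm_sub_le_of_regularSpace
    (hp : p ≠ ∞) {f : X → E} (hf : MemLp f p μ) {ε : ℝ≥0∞} (hε : ε ≠ 0) :
    ∃ g : X → E, HasCompactSupport g ∧ eLpNorm (f - g) p μ ≤ ε ∧ Continuous g ∧ MemLp g p μ := by
  suffices H :
      ∃ g : X → E, eLpNorm (f - g) p μ ≤ ε ∧ Continuous g ∧ MemLp g p μ ∧ HasCompactSupport g by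
    rcases H with ⟨g, hg, g_cont, g_mem, g_support⟩
    exact ⟨g, g_support, hg, g_cont, g_mem⟩
  apply hf.induction_dense hp _ _ _ _ hε
  rotate_left
  · rintro f g ⟨f_cont, f_mem, hf⟩ ⟨g_cont, g_mem, hg⟩
    exact ⟨f_cont.add g_cont, f_mem.add g_mem, hf.add hg⟩
  · rintro f ⟨_, f_mem, _⟩
    exact f_mem.aestronglyMeasurable
  intro c t ht htμ ε hε
  rcases exists_Lp_half E μ p hε with ⟨δ, δpos, hδ⟩
  obtain ⟨η, ηpos, hη⟩ := exists_eLpNorm_indicator_le (μ := μ) hp c δpos.ne'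
  have hη_pos' : (0 : ℝ≥0∞) < η := ENNReal.coe_pos.2 ηpos
  obtain ⟨s, st, s_compact, s_closed, μs⟩ :
      ∃ s, s ⊆ t ∧ IsCompact s ∧ IsClosed s ∧ μ (t \ s) < η :=
    ht.exists_isCompact_isClosed_sdiff_lt htμ.ne hη_pos'.ne'
  have hsμ : μ s < ∞ := (measure_mono st).trans_lt htμ
  obtain ⟨V, sV, V_open, -, hV⟩ : ∃ V, V ⊇ s ∧ IsOpen V ∧ μ V < ∞ ∧ μ (V \ s) < η :=
    s_closed.measurableSet.exists_isOpen_sdiff_lt hsμ.ne hη_pos'.ne'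
  obtain ⟨φ, φs, φV, φ_supp, φ_range⟩ := exists_continuous_one_zero_of_isCompact s_compact
    V_open.isClosed_compl (disjoint_compl_right_iff_subset.2 sV)
  have hcont : Continuous fun x => φ x • c := φ.continuous.smul continuous_const
  have hsupp : HasCompactSupport fun x => φ x • c := φ_supp.smul_right
  have hmem : MemLp (fun x => φ x • c) p μ := hcont.memLp_of_hasCompactSupport hsupp
  have I1 : eLpNorm ((s.indicator fun _ => c) - t.indicator fun _ => c) p μ ≤ δ := by
    rw [← eLpNorm_neg, neg_sub, ← indicator_sdiff st]
    exact hη _ μs.le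
  have I2 : eLpNorm ((fun x => φ x • c) - s.indicator fun _ => c) p μ ≤ δ := by
    refine (eLpNorm_mono fun x => ?_).trans (hη _ hV.le)
    by_cases hs : x ∈ s
    · simp [hs, φs hs]
    by_cases hv : x ∈ V
    · have := φ_range x
      simp only [Pi.sub_apply, hs, not_false_eq_true, indicator_of_notMem, sub_zero, Set.mem_sdiff, hv,
        and_self, indicator_of_mem, norm_smul, Real.norm_eq_abs, abs_of_nonneg this.1]
      exact mul_le_of_le_one_left (norm_nonneg _) this.2
    · simp [hs, hv, φV hv]
  refine ⟨_, ?_, hcont, hmem, hsupp⟩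
  have := (hδ _ _ (hmem.aestronglyMeasurable.sub
    (aestronglyMeasurable_const.indicator s_closed.measurableSet))
    ((aestronglyMeasurable_const.indicator s_closed.measurableSet).sub
      (aestronglyMeasurable_const.indicator ht)) I2 I1).le
  simpa only [sub_add_sub_cancel] using this

/-- Rapid approximation in `L^p`, and almost everywhere, by compactly supported continuous
functions. -/
theorem MeasureTheory.MemLp.exists_seq_hasCompactSupport (hp1 : 1 ≤ p) (hp : p ≠ ∞) {f : X → E}
    (hf : MemLp f p μ) :
    ∃ F : ℕ → X → E, (∀ n, Continuous (F n)) ∧ (∀ n, HasCompactSupport (F n)) ∧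
      (∀ n, MemLp (F n) p μ) ∧ (∀ n, eLpNorm (f - F n) p μ ≤ (2⁻¹ : ℝ≥0∞) ^ n) ∧
      ∀ᵐ x ∂μ, Tendsto (fun n => F n x) atTop (𝓝 (f x)) := by
  have h2 : ∀ n : ℕ, (2⁻¹ : ℝ≥0∞) ^ n ≠ 0 := fun n => pow_ne_zero _ (by simp)
  choose F hFs hFn hFc hFm using fun n : ℕ =>
    hf.exists_hasCompactSupport_eLpNorm_sub_le_of_regularSpace hp (h2 n)
  have hlim : Tendsto (fun n => eLpNorm (F n - f) p μ) atTop (𝓝 0) := by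
    have h0 : Tendsto (fun n : ℕ => (2⁻¹ : ℝ≥0∞) ^ n) atTop (𝓝 0) :=
      ENNReal.tendsto_pow_atTop_nhds_zero_of_lt_one (by simp)
    refine tendsto_of_tendsto_of_tendsto_of_le_of_le tendsto_const_nhds h0 (fun _ => zero_le)
      fun n => ?_
    rw [eLpNorm_sub_comm]
    exact hFn n
  obtain ⟨ns, hns, hae⟩ := (tendstoInMeasure_of_tendsto_eLpNorm (by positivity)
    (fun n => (hFm n).1) hf.1 hlim).exists_seq_tendsto_ae
  refine ⟨fun n => F (ns n), fun n => hFc _, fun n => hFs _, fun n => hFm _, fun n => ?_, hae⟩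
  exact (hFn _).trans (pow_le_pow_of_le_one (by simp) (by simp) (hns.id_le n))

/-- An increasing sequence of compactly supported continuous functions, bounded in `L^p`, that
dominates a rapidly convergent sequence: the partial sums of `|F 0| + ∑ |F (i + 1) - F i|`. -/
theorem exists_monotone_dominating (hp1 : 1 ≤ p) {f : X → E} (hf : MemLp f p μ)
    {F : ℕ → X → E} (hFc : ∀ n, Continuous (F n)) (hFs : ∀ n, HasCompactSupport (F n))
    (hFm : ∀ n, MemLp (F n) p μ) (hF : ∀ n, eLpNorm (f - F n) p μ ≤ (2⁻¹ : ℝ≥0∞) ^ n) :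
    ∃ D : ℕ → X → ℝ, (∀ n, Continuous (D n)) ∧ (∀ n, HasCompactSupport (D n)) ∧
      (∀ x, Monotone fun n => D n x) ∧ (∀ n x, ‖F n x‖ ≤ D n x) ∧
      ∃ C : ℝ≥0∞, C ≠ ∞ ∧ ∀ n, eLpNorm (D n) p μ ≤ C := by
  let D : ℕ → X → ℝ := fun n x => ‖F 0 x‖ + ∑ i ∈ Finset.range n, ‖F (i + 1) x - F i x‖
  have hD : ∀ n x, D (n + 1) x = D n x + ‖F (n + 1) x - F n x‖ := fun n x => by
    simp only [D, Finset.sum_range_succ, add_assoc]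
  have hc : ∀ n, Continuous (D n) := fun n =>
    (hFc 0).norm.add (continuous_finsetSum _ fun i _ => ((hFc _).sub (hFc _)).norm)
  have hD0 : D 0 = fun x => ‖F 0 x‖ := by ext x; simp [D]
  have hD1 : ∀ n, D (n + 1) = D n + fun x => ‖F (n + 1) x - F n x‖ := fun n => by
    ext x; exact hD n x
  have hs : ∀ n, HasCompactSupport (D n) := fun n => by
    induction n with
    | zero => rw [hD0]; exact (hFs 0).norm
    | succ n ih => rw [hD1]; exact ih.add ((hFs _).sub (hFs _)).norm
  refine ⟨D, hc, hs, fun x => monotone_nat_of_le_succ fun n => ?_, fun n x => ?_,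
    eLpNorm (F 0) p μ + 4, by simpa using (hFm 0).2.ne, fun n => ?_⟩
  · rw [hD]
    exact le_add_of_nonneg_right (norm_nonneg _)
  · induction n with
    | zero => simp [D]
    | succ n ih =>
      rw [hD]
      calc ‖F (n + 1) x‖ = ‖F n x + (F (n + 1) x - F n x)‖ := by rw [add_sub_cancel]
        _ ≤ _ := (norm_add_le _ _).trans (by gcongr)
  · have h1 : ∀ n, eLpNorm (D n) p μ ≤
        eLpNorm (F 0) p μ + ∑ i ∈ Finset.range n, 2 * (2⁻¹ : ℝ≥0∞) ^ i := by
      intro n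
      induction n with
      | zero =>
        rw [hD0, eLpNorm_norm]
        simp
      | succ n ih =>
        rw [hD1, Finset.sum_range_succ, ← add_assoc]
        have hdm := ((hFm (n + 1)).sub (hFm n)).1
        refine (eLpNorm_add_le ((hc n).stronglyMeasurable_of_hasCompactSupport
          (hs n)).aestronglyMeasurable hdm.norm hp1).trans (add_le_add ih ?_)
        have h2 : F (n + 1) - F n = (f - F n) - (f - F (n + 1)) := by abel
        rw [eLpNorm_norm (F (n + 1) - F n), h2, two_mul]
        refine (eLpNorm_sub_le (hf.sub (hFm n)).1 (hf.sub (hFm _)).1 hp1).trans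
          (add_le_add (hF n) ((hF _).trans ?_))
        exact pow_le_pow_of_le_one (by simp) (by simp) n.le_succ
    refine (h1 n).trans ?_
    gcongr
    rw [← Finset.mul_sum]
    have h4 : ∑ i ∈ Finset.range n, (2⁻¹ : ℝ≥0∞) ^ i ≤ 2 := by
      refine (ENNReal.sum_le_tsum _).trans ?_
      rw [ENNReal.tsum_geometric, ENNReal.one_sub_inv_two, inv_inv]
    calc 2 * ∑ i ∈ Finset.range n, (2⁻¹ : ℝ≥0∞) ^ i ≤ 2 * 2 := by gcongr
      _ = 4 := by norm_num

/-- No countability assumption is needed, since `k` is a limit of compactly supported functions. -/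
theorem MeasureTheory.MemLp.aestronglyMeasurable_smul_of_continuous {𝕜 : Type*} [RCLike 𝕜]
    [NormedSpace 𝕜 E] (hp1 : 1 ≤ p) (hp : p ≠ ∞) {k : X → 𝕜}
    (hk : MemLp k p μ) {F : X → E} (hF : Continuous F) :
    AEStronglyMeasurable (fun x => k x • F x) μ := by
  obtain ⟨K, hc, hs, -, -, hae⟩ := hk.exists_seq_hasCompactSupport hp1 hp
  refine aestronglyMeasurable_of_tendsto_ae (u := atTop) (f := fun n x => K n x • F x)
    (fun n => ?_) ?_
  · exact (((hc n).smul hF).stronglyMeasurable_of_hasCompactSupport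
      ((hs n).smul_right)).aestronglyMeasurable
  · filter_upwards [hae] with x hx using hx.smul_const _

end Approximation

/-! ### Integrated forms and the left regular representation -/

section IntegratedForm

variable {G : Type*} [TopologicalSpace G] [Group G] [IsTopologicalGroup G]
    [LocallyCompactSpace G] [MeasurableSpace G] [BorelSpace G]
    {ν : Measure G} [Regular ν] {𝕜 : Type*} [RCLike 𝕜]
    {E : Type*} [NormedAddCommGroup E] [NormedSpace 𝕜 E] [NormedSpace ℝ E] [SMulCommClass ℝ 𝕜 E]

theorem integrable_smul_rep {k : G → 𝕜} (hk : Integrable k ν) {π : G →* (E →L[𝕜] E)}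
    (hc : ∀ f, Continuous fun x => π x f) (hb : ∃ B : ℝ, ∀ x, ‖π x‖ ≤ B) (f : E) :
    Integrable (fun x => k x • π x f) ν := by
  obtain ⟨B, hB⟩ := hb
  refine Integrable.mono' (g := fun x => ‖k x‖ * (B * ‖f‖)) (hk.norm.mul_const _) ?_ ?_
  · exact (memLp_one_iff_integrable.2 hk).aestronglyMeasurable_smul_of_continuous le_rfl
      (by simp) (hc f)
  · refine ae_of_all _ fun x => ?_
    rw [norm_smul]
    gcongr
    exact (π x).le_of_opNorm_le (hB x) f

theorem norm_integral_smul_rep_le (k : G → 𝕜) (hk : Integrable k ν) {π : G →* (E →L[𝕜] E)}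
    {B : ℝ} (hB : ∀ x, ‖π x‖ ≤ B) (f : E) :
    ‖∫ x, k x • π x f ∂ν‖ ≤ (B * ∫ x, ‖k x‖ ∂ν) * ‖f‖ := by
  have : (B * ∫ x, ‖k x‖ ∂ν) * ‖f‖ = ∫ x, ‖k x‖ * (B * ‖f‖) ∂ν := by
    rw [integral_mul_const]; ring
  rw [this]
  refine norm_integral_le_of_norm_le (hk.norm.mul_const _) (ae_of_all _ fun x => ?_)
  rw [norm_smul]
  gcongr
  exact (π x).le_of_opNorm_le (hB x) f

variable (ν) in
/-- The integrated form `f ↦ ∫ k(x) π(x) f dν(x)` of a uniformly bounded strongly continuous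
representation `π`. -/
noncomputable def integratedForm (π : G →* (E →L[𝕜] E)) (hc : ∀ f, Continuous fun x => π x f)
    (hb : ∃ B : ℝ, ∀ x, ‖π x‖ ≤ B) (k : G → 𝕜) (hk : Integrable k ν) : E →L[𝕜] E :=
  LinearMap.mkContinuousOfExistsBound
    { toFun := fun f => ∫ x, k x • π x f ∂ν
      map_add' := fun f g => by
        rw [← integral_add (integrable_smul_rep hk hc hb f) (integrable_smul_rep hk hc hb g)]
        simp
      map_smul' := fun c f => by
        rw [RingHom.id_apply, ← integral_smul]
        congr 1 with x
        rw [map_smul, smul_comm] }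
    (by
      obtain ⟨B, hB⟩ := hb
      exact ⟨B * ∫ x, ‖k x‖ ∂ν, norm_integral_smul_rep_le k hk hB⟩)

variable {π : G →* (E →L[𝕜] E)} {hc : ∀ f, Continuous fun x => π x f}
  {hb : ∃ B : ℝ, ∀ x, ‖π x‖ ≤ B} {k : G → 𝕜} {hk : Integrable k ν}

theorem integratedForm_apply (f : E) :
    integratedForm ν π hc hb k hk f = ∫ x, k x • π x f ∂ν := rfl

theorem norm_integratedForm_apply_le {B : ℝ} (hB : ∀ x, ‖π x‖ ≤ B) (f : E) :
    ‖integratedForm ν π hc hb k hk f‖ ≤ (B * ∫ x, ‖k x‖ ∂ν) * ‖f‖ :=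
  norm_integral_smul_rep_le k hk hB f

theorem integratedForm_sub {l : G → 𝕜} {hl : Integrable l ν} {hkl : Integrable (k - l) ν} (f : E) :
    integratedForm ν π hc hb (k - l) hkl f =
      integratedForm ν π hc hb k hk f - integratedForm ν π hc hb l hl f := by
  simp only [integratedForm_apply]
  rw [← integral_sub (integrable_smul_rep hk hc hb f) (integrable_smul_rep hl hc hb f)]
  simp [sub_smul]

theorem integratedForm_add {l : G → 𝕜} {hl : Integrable l ν} {hkl : Integrable (k + l) ν} :
    integratedForm ν π hc hb (k + l) hkl =
      integratedForm ν π hc hb k hk + integratedForm ν π hc hb l hl := by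
  ext1 f
  refine Eq.trans ?_
    (integral_add (integrable_smul_rep hk hc hb f) (integrable_smul_rep hl hc hb f))
  exact integral_congr_ae (ae_of_all _ fun x => add_smul _ _ _)

theorem integratedForm_smul {c : 𝕜} {hck : Integrable (c • k) ν} :
    integratedForm ν π hc hb (c • k) hck = c • integratedForm ν π hc hb k hk := by
  ext1 f
  refine Eq.trans ?_ (integral_smul c fun x => k x • π x f)
  exact integral_congr_ae (ae_of_all _ fun x => mul_smul c (k x) (π x f))

/-- A bounded operator that intertwines two representations intertwines their integrated forms. -/
theorem map_integratedForm [CompleteSpace E] {F : Type*} [NormedAddCommGroup F] [NormedSpace 𝕜 F]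
    [NormedSpace ℝ F] [SMulCommClass ℝ 𝕜 F] [CompleteSpace F] {π' : G →* (F →L[𝕜] F)}
    {hc' : ∀ f, Continuous fun x => π' x f} {hb' : ∃ B : ℝ, ∀ x, ‖π' x‖ ≤ B} (V : E →L[𝕜] F)
    (hV : ∀ x f, V (π x f) = π' x (V f)) (f : E) :
    V (integratedForm ν π hc hb k hk f) = integratedForm ν π' hc' hb' k hk (V f) := by
  rw [integratedForm_apply, integratedForm_apply,
    ← ContinuousLinearMap.integral_comp_comm V (integrable_smul_rep hk hc hb f)]
  simp [hV]

end IntegratedForm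

section LeftRegular

variable {G : Type*} [TopologicalSpace G] [Group G] [IsTopologicalGroup G]
    [LocallyCompactSpace G] [MeasurableSpace G] [BorelSpace G]
    (ν : Measure G) [IsMulLeftInvariant ν] [Regular ν] (𝕜 : Type*) [RCLike 𝕜]
    (E : Type*) [NormedAddCommGroup E] [NormedSpace 𝕜 E] (p : ℝ≥0∞) [Fact (1 ≤ p)]

/-- The left regular representation `(λ(y) g)(x) = g(y⁻¹ x)` on `L^p(G; E)`. -/
noncomputable def leftRegular : G →* (Lp E p ν →L[𝕜] Lp E p ν) where
  toFun y := (Lp.compMeasurePreservingₗᵢ 𝕜 (y⁻¹ * ·)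
    (measurePreserving_mul_left ν y⁻¹)).toContinuousLinearMap
  map_one' := by
    ext1 g
    apply Lp.ext
    have h := Lp.coeFn_compMeasurePreserving g (measurePreserving_mul_left ν (1 : G)⁻¹)
    filter_upwards [h] with x hx
    refine hx.trans ?_
    simp
  map_mul' y z := by
    ext1 g
    apply Lp.ext
    have h := Lp.coeFn_compMeasurePreserving g (measurePreserving_mul_left ν (y * z)⁻¹)
    have h1 := Lp.coeFn_compMeasurePreserving g (measurePreserving_mul_left ν z⁻¹)
    have h2 := Lp.coeFn_compMeasurePreserving (Lp.compMeasurePreserving _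
      (measurePreserving_mul_left ν z⁻¹) g) (measurePreserving_mul_left ν y⁻¹)
    have h3 := (measurePreserving_mul_left ν y⁻¹).quasiMeasurePreserving.ae_eq_comp h1
    filter_upwards [h, h2, h3] with x hx hx2 hx3
    refine hx.trans (Eq.trans ?_ (hx2.trans hx3).symm)
    simp [mul_assoc]

variable {ν 𝕜 E p}

theorem leftRegular_coeFn (y : G) (g : Lp E p ν) :
    leftRegular ν 𝕜 E p y g =ᵐ[ν] fun x => g (y⁻¹ * x) :=
  Lp.coeFn_compMeasurePreserving g (measurePreserving_mul_left ν y⁻¹)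

theorem leftRegular_toLp_coeFn (y : G) {g : G → E} (hg : MemLp g p ν) :
    leftRegular ν 𝕜 E p y (hg.toLp g) =ᵐ[ν] fun x => g (y⁻¹ * x) :=
  (leftRegular_coeFn y _).trans
    ((measurePreserving_mul_left ν y⁻¹).quasiMeasurePreserving.ae_eq_comp hg.coeFn_toLp)

theorem norm_leftRegular_apply (y : G) (g : Lp E p ν) : ‖leftRegular ν 𝕜 E p y g‖ = ‖g‖ :=
  (Lp.compMeasurePreservingₗᵢ 𝕜 (y⁻¹ * ·) (measurePreserving_mul_left ν y⁻¹)).norm_map g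

theorem norm_leftRegular_le (y : G) : ‖leftRegular ν 𝕜 E p y‖ ≤ 1 :=
  ContinuousLinearMap.opNorm_le_bound _ zero_le_one fun g => by
    rw [norm_leftRegular_apply, one_mul]

theorem bounded_leftRegular : ∃ B : ℝ, ∀ y, ‖leftRegular ν 𝕜 E p y‖ ≤ B :=
  ⟨1, norm_leftRegular_le⟩

theorem continuous_leftRegular (hp : p ≠ ∞) (g : Lp E p ν) :
    Continuous fun y => leftRegular ν 𝕜 E p y g := by
  have hc : Continuous fun y : G => (⟨fun x => y⁻¹ * x, by fun_prop⟩ : C(G, G)) := by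
    apply ContinuousMap.continuous_of_continuous_uncurry
    simp only [Function.uncurry_def, ContinuousMap.coe_mk]
    fun_prop
  exact Continuous.compMeasurePreservingLp (continuous_const (y := g)) hc
    (fun y => measurePreserving_mul_left ν y⁻¹) hp

end LeftRegular

/-! ### Convolution of compactly supported continuous functions -/

section Inversion

variable {G : Type*} [TopologicalSpace G] [Group G] [IsTopologicalGroup G]
    [LocallyCompactSpace G] [T2Space G] [MeasurableSpace G] [BorelSpace G]
    (ν : Measure G) [IsHaarMeasure ν] [Regular ν]

/-- Inversion changes the Haar measure by a continuous positive density. The density is the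
modular function, but only its continuity and positivity matter below. -/
theorem exists_continuous_pos_integral_eq_integral_inv :
    ∃ w : G → ℝ, Continuous w ∧ (∀ x, 0 < w x) ∧ ∀ f : G → ℝ, Continuous f → HasCompactSupport f →
      ∫ x, f x ∂ν = ∫ x, f x⁻¹ * w x⁻¹ ∂ν := by
  obtain ⟨⟨g, g_cont⟩, g_comp, g_nonneg, g_one⟩ :
    ∃ (g : C(G, ℝ)), HasCompactSupport g ∧ 0 ≤ g ∧ g 1 ≠ 0 := exists_continuous_nonneg_pos 1
  have int_g_pos : 0 < ∫ x, g x ∂ν :=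
    g_cont.integral_pos_of_hasCompactSupport_nonneg_nonzero g_comp g_nonneg g_one
  let D : G → ℝ := fun x => ∫ y, g (y⁻¹ * x) ∂ν.inv
  have D_cont : Continuous D := continuous_integral_apply_inv_mul g_cont g_comp
  have D_pos : ∀ x, 0 < D x := by
    intro x
    have C : Continuous (fun y ↦ g (y⁻¹ * x)) := by fun_prop
    refine C.integral_pos_of_hasCompactSupport_nonneg_nonzero (x := x) ?_
      (fun y => g_nonneg (y⁻¹ * x)) (by simpa using g_one)
    exact g_comp.comp_homeomorph ((Homeomorph.inv G).trans (Homeomorph.mulRight x))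
  refine ⟨fun x => (D x)⁻¹ * ∫ x, g x ∂ν, (D_cont.inv₀ fun x => (D_pos x).ne').mul
    continuous_const, fun x => mul_pos (inv_pos.2 (D_pos x)) int_g_pos, fun f hf h'f => ?_⟩
  have key := integral_isMulLeftInvariant_isMulRightInvariant_combo (μ := ν) (ν := ν.inv) hf h'f
    g_cont g_comp g_nonneg g_one
  rw [key, ← integral_mul_const, Measure.inv, integral_map measurable_inv.aemeasurable]
  · simp [D, mul_assoc, Measure.inv]
  · exact ((hf.mul (D_cont.inv₀ fun x => (D_pos x).ne')).mul
      continuous_const).stronglyMeasurable_of_hasCompactSupport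
        (h'f.mul_right.mul_right) |>.aestronglyMeasurable

open scoped Pointwise in
/-- The inverse of a null set is locally null. -/
theorem measure_inv_inter_eq_zero_of_isCompact {N K : Set G} (hN : ν N = 0) (hK : IsCompact K) :
    ν (N⁻¹ ∩ K) = 0 := by
  obtain ⟨w, w_cont, w_pos, hw⟩ := exists_continuous_pos_integral_eq_integral_inv ν
  obtain ⟨K', hK', hKK'⟩ := exists_compact_superset hK
  -- On a compact neighbourhood of `K` the density of inversion is bounded below by some `δ > 0`, so
  -- an open set `U ⊇ N` of small measure has an inverse of small measure there.
  obtain ⟨δ, δ_pos, hδ⟩ : ∃ δ : ℝ, 0 < δ ∧ ∀ x ∈ K', δ ≤ w x⁻¹ := by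
    rcases K'.eq_empty_or_nonempty with rfl | hne
    · exact ⟨1, one_pos, by simp⟩
    · obtain ⟨x, -, hx⟩ := hK'.exists_isMinOn hne (w_cont.comp continuous_inv).continuousOn
      exact ⟨w x⁻¹, w_pos _, fun y hy => hx hy⟩
  refine le_antisymm (ENNReal.le_of_forall_pos_le_add fun ε hε _ => ?_) zero_le
  have hε' : ν N < ENNReal.ofReal (δ * ε) := by
    rw [hN]; exact ENNReal.ofReal_pos.2 (mul_pos δ_pos hε)
  obtain ⟨U, hNU, hU, hUε⟩ := N.exists_isOpen_lt_of_lt _ hε'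
  have hW : IsOpen (U⁻¹ ∩ interior K') := hU.inv.inter isOpen_interior
  refine (measure_mono (Set.inter_subset_inter (Set.inv_subset_inv.2 hNU) hKK')).trans ?_
  rw [hW.measure_eq_iSup_isCompact, zero_add]
  refine iSup₂_le fun L hLW => iSup_le fun hL => ?_
  obtain ⟨φ, φL, φW, φ_supp, φ_range⟩ := exists_continuous_one_zero_of_isCompact hL
    hW.isClosed_compl (Set.disjoint_compl_right_iff_subset.2 hLW)
  have hφi : Integrable φ ν := φ.continuous.integrable_of_hasCompactSupport φ_supp
  have hφ' : Continuous fun x => φ x⁻¹ := φ.continuous.comp continuous_inv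
  have φ'_supp : HasCompactSupport fun x => φ x⁻¹ := φ_supp.comp_homeomorph (Homeomorph.inv G)
  have h1 : δ * ∫ x, φ x ∂ν ≤ ∫ x, φ x⁻¹ ∂ν := by
    rw [hw _ hφ' φ'_supp, ← integral_const_mul]
    simp only [inv_inv]
    refine integral_mono (hφi.const_mul _) ?_ fun x => ?_
    · exact (φ.continuous.mul (w_cont.comp continuous_inv)).integrable_of_hasCompactSupport
        φ_supp.mul_right
    · by_cases hx : x ∈ U⁻¹ ∩ interior K'
      · change δ * φ x ≤ φ x * w x⁻¹
        rw [mul_comm]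
        exact mul_le_mul_of_nonneg_left (hδ x (interior_subset hx.2)) (φ_range x).1
      · simp [φW hx]
  have h2 : ENNReal.ofReal (∫ x, φ x⁻¹ ∂ν) ≤ ν U := by
    rw [ofReal_integral_eq_lintegral_ofReal (hφ'.integrable_of_hasCompactSupport φ'_supp)
      (ae_of_all _ fun x => (φ_range _).1), ← lintegral_indicator_one hU.measurableSet]
    refine lintegral_mono fun x => ?_
    by_cases hx : x ∈ U
    · simpa [hx] using (φ_range x⁻¹).2
    · have : φ x⁻¹ = 0 := φW fun h => hx (by simpa using h.1)
      simp [hx, this]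
  have h3 : ν L ≤ ENNReal.ofReal (∫ x, φ x ∂ν) := by
    rw [ofReal_integral_eq_lintegral_ofReal hφi (ae_of_all _ fun x => (φ_range _).1)]
    calc ν L = ∫⁻ x, L.indicator 1 x ∂ν := (lintegral_indicator_one hL.measurableSet).symm
      _ ≤ _ := lintegral_mono fun x => by
        by_cases hx : x ∈ L
        · simp [hx, φL hx]
        · simp [hx]
  refine h3.trans ?_
  have h4 : ENNReal.ofReal (δ * ∫ x, φ x ∂ν) ≤ ENNReal.ofReal (δ * ε) :=
    ((ENNReal.ofReal_le_ofReal h1).trans h2).trans hUε.le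
  rw [ENNReal.ofReal_le_ofReal_iff (by positivity), mul_le_mul_iff_right₀ δ_pos] at h4
  simpa using ENNReal.ofReal_le_ofReal h4

variable {ν} in
/-- A property that holds almost everywhere holds at `y⁻¹ * x` for almost every `y` in a given
compact set. Without `σ`-finiteness this need not extend to almost every `y` in `G`. -/
theorem ae_mem_imp_inv_mul_of_isCompact {P : G → Prop} (hP : ∀ᵐ z ∂ν, P z) {K : Set G}
    (hK : IsCompact K) (x : G) : ∀ᵐ y ∂ν, y ∈ K → P (y⁻¹ * x) := by
  have h := measure_inv_inter_eq_zero_of_isCompact ν (N := {z | ¬ P z}) (ae_iff.1 hP)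
    (hK.image (continuous_const_mul x⁻¹))
  rw [ae_iff, ← h, ← measure_preimage_mul ν x⁻¹ ({z | ¬ P z}⁻¹ ∩ _)]
  congr 1
  ext y
  simp [and_comm]

end Inversion

section SetIntegral

variable {X : Type*} [MeasurableSpace X] {ν : Measure X} {𝕜 E : Type*} [RCLike 𝕜]
    [NormedAddCommGroup E] [NormedSpace 𝕜 E] [NormedSpace ℝ E] [SMulCommClass ℝ 𝕜 E]
    {p : ℝ≥0∞} [Fact (1 ≤ p)]

/-- Integration over a set of finite measure is a bounded functional on `L^p`. -/
theorem exists_setIntegralCLM {s : Set X} (hνs : ν s < ∞) :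
    ∃ φ : Lp E p ν →L[𝕜] E, ∀ h : Lp E p ν, φ h = ∫ x in s, h x ∂ν := by
  have hp1 : 1 ≤ p := Fact.out
  have : IsFiniteMeasure (ν.restrict s) := ⟨by simpa using hνs⟩
  have hmem : ∀ h : Lp E p ν, MemLp h 1 (ν.restrict s) := fun h =>
    ((Lp.memLp h).restrict s).mono_exponent hp1
  have hint : ∀ h : Lp E p ν, IntegrableOn h s ν := fun h => memLp_one_iff_integrable.1 (hmem h)
  let C : ℝ≥0∞ := ν.restrict s Set.univ ^ (1 / (1 : ℝ≥0∞).toReal - 1 / p.toReal)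
  have hC : C ≠ ∞ := by
    refine ENNReal.rpow_ne_top_of_nonneg ?_ (by simpa using hνs.ne)
    rcases eq_or_ne p ∞ with rfl | hp
    · simp
    · have : 1 ≤ p.toReal := by simpa using ENNReal.toReal_mono hp hp1
      simp only [ENNReal.toReal_one, div_one, sub_nonneg]
      exact (div_le_one (by positivity)).2 this
  refine ⟨LinearMap.mkContinuous
    { toFun := fun h => ∫ x in s, h x ∂ν
      map_add' := fun f g => by
        rw [← integral_add (hint f) (hint g)]
        exact integral_congr_ae (ae_restrict_of_ae (Lp.coeFn_add f g))
      map_smul' := fun c f => by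
        rw [RingHom.id_apply, ← integral_smul]
        exact integral_congr_ae (ae_restrict_of_ae (Lp.coeFn_smul c f)) } C.toReal fun h => ?_,
    fun h => rfl⟩
  change ‖∫ x in s, h x ∂ν‖ ≤ _
  refine (norm_integral_le_lintegral_norm _).trans ?_
  simp_rw [ofReal_norm]
  rw [← eLpNorm_one_eq_lintegral_enorm, mul_comm, Lp.norm_def, ← ENNReal.toReal_mul]
  refine ENNReal.toReal_mono (ENNReal.mul_ne_top (Lp.eLpNorm_ne_top h) hC) ?_
  refine (eLpNorm_le_eLpNorm_mul_rpow_measure_univ hp1 (hmem h).1).trans ?_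
  gcongr
  exact Measure.restrict_le_self

theorem MeasureTheory.Lp.ae_eq_of_forall_setIntegral_eq_memLp [CompleteSpace E] (hp : p ≠ ∞)
    (A : Lp E p ν) {f : X → E} (hf : MemLp f p ν)
    (h : ∀ s, MeasurableSet s → ν s < ∞ → ∫ x in s, A x ∂ν = ∫ x in s, f x ∂ν) : A =ᵐ[ν] f := by
  have hp0 : p ≠ 0 := (one_pos.trans_le (Fact.out : 1 ≤ p)).ne'
  have hint : ∀ (h : Lp E p ν) (s : Set X), MeasurableSet s → ν s < ∞ → IntegrableOn h s ν := by
    intro h s _ hνs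
    have : IsFiniteMeasure (ν.restrict s) := ⟨by simpa using hνs⟩
    exact memLp_one_iff_integrable.1 (((Lp.memLp h).restrict s).mono_exponent Fact.out)
  refine (Lp.ae_eq_of_forall_setIntegral_eq A (hf.toLp f) hp0 hp (hint _) (hint _)
    fun s hs hνs => ?_).trans hf.coeFn_toLp
  rw [h s hs hνs, integral_congr_ae (ae_restrict_of_ae hf.coeFn_toLp)]

end SetIntegral

section Convolution

variable {G : Type*} [TopologicalSpace G] [Group G] [IsTopologicalGroup G]
    [LocallyCompactSpace G] [MeasurableSpace G] [BorelSpace G]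
    {ν : Measure G} [IsHaarMeasure ν] [Regular ν] {𝕜 E : Type*} [RCLike 𝕜]
    [NormedAddCommGroup E] [NormedSpace 𝕜 E] [NormedSpace ℝ E] [SMulCommClass ℝ 𝕜 E]
    {p : ℝ≥0∞} [Fact (1 ≤ p)]

theorem continuous_integral_mul_inv_mul {k : G → 𝕜} {g : G → E} (hk : Continuous k)
    (hks : HasCompactSupport k) (hg : Continuous g) :
    Continuous fun x => ∫ y, k y • g (y⁻¹ * x) ∂ν := by
  rw [← continuousOn_univ]
  refine continuousOn_integral_of_compact_support (k := tsupport k) hks ?_ fun x y _ hy => ?_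
  · have h1 : Continuous fun z : G × G => k z.2 := hk.comp continuous_snd
    have h2 : Continuous fun z : G × G => g (z.2⁻¹ * z.1) :=
      hg.comp (continuous_snd.inv.mul continuous_fst)
    exact (h1.smul h2).continuousOn
  · simp [image_eq_zero_of_notMem_tsupport hy]

open scoped Pointwise in
theorem hasCompactSupport_integral_mul_inv_mul {k : G → 𝕜} {g : G → E} (hks : HasCompactSupport k)
    (hgs : HasCompactSupport g) : HasCompactSupport fun x => ∫ y, k y • g (y⁻¹ * x) ∂ν := by
  refine HasCompactSupport.intro (IsCompact.mul hks hgs) fun x hx => ?_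
  rw [integral_eq_zero_of_ae (ae_of_all _ fun y => ?_)]
  by_cases h1 : y ∈ tsupport k
  · have : y⁻¹ * x ∉ tsupport g := fun h => hx ⟨y, h1, _, h, by simp⟩
    simp [image_eq_zero_of_notMem_tsupport this]
  · simp [image_eq_zero_of_notMem_tsupport h1]

open scoped Pointwise in
/-- The pointwise formula for convolutions of compactly supported continuous functions. Both sides
have the same integral over every set of finite measure. -/
theorem integratedForm_leftRegular_toLp [CompleteSpace E] (hp : p ≠ ∞) {k : G → 𝕜} {g : G → E}
    (hk : Continuous k) (hks : HasCompactSupport k) (hki : Integrable k ν) (hg : Continuous g)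
    (hgs : HasCompactSupport g) (hgm : MemLp g p ν) :
    integratedForm ν (leftRegular ν 𝕜 E p) (continuous_leftRegular hp) bounded_leftRegular k hki
      (hgm.toLp g) =ᵐ[ν] fun x => ∫ y, k y • g (y⁻¹ * x) ∂ν := by
  have hcm : MemLp (fun x => ∫ y, k y • g (y⁻¹ * x) ∂ν) p ν :=
    (continuous_integral_mul_inv_mul hk hks hg).memLp_of_hasCompactSupport
      (hasCompactSupport_integral_mul_inv_mul hks hgs)
  refine Lp.ae_eq_of_forall_setIntegral_eq_memLp hp _ hcm fun s hs hνs => ?_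
  obtain ⟨φ, hφ⟩ := exists_setIntegralCLM (𝕜 := 𝕜) (E := E) (p := p) hνs
  have hφ' : ∀ y, φ (k y • leftRegular ν 𝕜 E p y (hgm.toLp g)) =
      ∫ x in s, k y • g (y⁻¹ * x) ∂ν := fun y => by
    have h1 : φ (leftRegular ν 𝕜 E p y (hgm.toLp g)) = ∫ x in s, g (y⁻¹ * x) ∂ν := by
      rw [hφ]
      exact integral_congr_ae (ae_restrict_of_ae (leftRegular_toLp_coeFn y hgm))
    rw [map_smul, h1, integral_smul]
  rw [← hφ, integratedForm_apply, ← ContinuousLinearMap.integral_comp_comm φ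
    (integrable_smul_rep hki (continuous_leftRegular hp) bounded_leftRegular _)]
  simp only [hφ']
  have hcont : Continuous (Function.uncurry fun x y => k y • g (y⁻¹ * x)) := by
    have h1 : Continuous fun z : G × G => k z.2 := hk.comp continuous_snd
    have h2 : Continuous fun z : G × G => g (z.2⁻¹ * z.1) :=
      hg.comp (continuous_snd.inv.mul continuous_fst)
    exact h1.smul h2
  have hsupp : HasCompactSupport (Function.uncurry fun x y => k y • g (y⁻¹ * x)) := by
    refine HasCompactSupport.intro ((IsCompact.mul hks hgs).prod hks) fun z hz => ?_
    by_cases h1 : z.2 ∈ tsupport k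
    · have : z.2⁻¹ * z.1 ∉ tsupport g := fun h => hz ⟨⟨z.2, h1, _, h, by simp⟩, h1⟩
      simp [Function.uncurry_def, image_eq_zero_of_notMem_tsupport this]
    · simp [Function.uncurry_def, image_eq_zero_of_notMem_tsupport h1]
  exact (integral_integral_swap_of_hasCompactSupport hcont hsupp).symm

end Convolution

/-! ### Convolution operators as integrated forms -/

section ConvolutionOperator

variable {G : Type*} [TopologicalSpace G] [Group G] [IsTopologicalGroup G]
    [LocallyCompactSpace G] [T2Space G] [MeasurableSpace G] [BorelSpace G]
    {ν : Measure G} [IsHaarMeasure ν] [Regular ν] {p : ℝ≥0∞} [Fact (1 ≤ p)]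

/-- Convolutions of increasing sequences of compactly supported continuous functions that are
bounded in `L¹` and in `L^p` remain finite in the limit, almost everywhere. -/
theorem ae_iSup_lintegral_mul_inv_mul_lt_top (hp : p ≠ ∞) {K D : ℕ → G → ℝ}
    (hKc : ∀ n, Continuous (K n)) (hKs : ∀ n, HasCompactSupport (K n))
    (hKm : ∀ x, Monotone fun n => K n x) (hK0 : ∀ n x, 0 ≤ K n x) {A : ℝ≥0∞} (hA : A ≠ ∞)
    (hKA : ∀ n, eLpNorm (K n) 1 ν ≤ A)
    (hDc : ∀ n, Continuous (D n)) (hDs : ∀ n, HasCompactSupport (D n))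
    (hDm : ∀ x, Monotone fun n => D n x) (hD0 : ∀ n x, 0 ≤ D n x) {B : ℝ≥0∞} (hB : B ≠ ∞)
    (hDB : ∀ n, eLpNorm (D n) p ν ≤ B) :
    ∀ᵐ x ∂ν, ⨆ n, ∫⁻ y, ENNReal.ofReal (K n y * D n (y⁻¹ * x)) ∂ν < ∞ := by
  have hp0 : p ≠ 0 := (one_pos.trans_le (Fact.out : 1 ≤ p)).ne'
  have hpr : 0 < p.toReal := ENNReal.toReal_pos hp0 hp
  have hKi : ∀ n, Integrable (K n) ν := fun n => (hKc n).integrable_of_hasCompactSupport (hKs n)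
  have hDi : ∀ n, MemLp (D n) p ν := fun n => (hDc n).memLp_of_hasCompactSupport (hDs n)
  let J : ℕ → G → ℝ := fun n x => ∫ y, K n y • D n (y⁻¹ * x) ∂ν
  have hJc : ∀ n, Continuous (J n) := fun n => continuous_integral_mul_inv_mul (hKc n) (hKs n)
    (hDc n)
  have hint : ∀ n x, Integrable (fun y => K n y • D n (y⁻¹ * x)) ν := fun n x =>
    Continuous.integrable_of_hasCompactSupport
      ((hKc n).smul ((hDc n).comp (continuous_inv.mul continuous_const))) (hKs n).smul_right
  have hnn : ∀ n x y, 0 ≤ K n y • D n (y⁻¹ * x) := fun n x y => mul_nonneg (hK0 _ _) (hD0 _ _)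
  have hJ : ∀ n x, ∫⁻ y, ENNReal.ofReal (K n y * D n (y⁻¹ * x)) ∂ν = ENNReal.ofReal (J n x) :=
    fun n x => (ofReal_integral_eq_lintegral_ofReal (hint n x) (ae_of_all _ (hnn n x))).symm
  have hJm : ∀ x, Monotone fun n => J n x := fun x m n hmn =>
    integral_mono (hint m x) (hint n x) fun y =>
      mul_le_mul (hKm _ hmn) (hDm _ hmn) (hD0 _ _) (hK0 _ _)
  have hJB : ∀ n, eLpNorm (J n) p ν ≤ A * B := fun n => by
    have h1 := integratedForm_leftRegular_toLp hp (hKc n) (hKs n) (hKi n) (hDc n) (hDs n) (hDi n)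
    have h2 := norm_integratedForm_apply_le (hc := continuous_leftRegular hp)
      (hb := bounded_leftRegular) (hk := hKi n)
      (norm_leftRegular_le (ν := ν) (𝕜 := ℝ) (E := ℝ) (p := p)) ((hDi n).toLp _)
    rw [← eLpNorm_congr_ae h1, ← Lp.enorm_def, ← ofReal_norm]
    refine (ENNReal.ofReal_le_ofReal h2).trans ?_
    rw [one_mul, ENNReal.ofReal_mul (by positivity), ofReal_norm, Lp.enorm_toLp]
    refine mul_le_mul' ?_ (hDB n)
    rw [ofReal_integral_norm_eq_lintegral_enorm (hKi n), ← eLpNorm_one_eq_lintegral_enorm]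
    exact hKA n
  simp only [hJ]
  have hfin : ∫⁻ x, ⨆ n, ENNReal.ofReal (J n x) ^ p.toReal ∂ν < ∞ := by
    rw [lintegral_iSup (fun n => ((hJc n).measurable.ennreal_ofReal).pow_const _)
      fun m n hmn x => ENNReal.rpow_le_rpow (ENNReal.ofReal_le_ofReal (hJm x hmn)) hpr.le]
    refine (iSup_le fun n => ?_).trans_lt
      (ENNReal.rpow_lt_top_of_nonneg hpr.le (ENNReal.mul_ne_top hA hB))
    have h3 : ∀ x, ENNReal.ofReal (J n x) = ‖J n x‖ₑ := fun x =>
      (Real.enorm_of_nonneg (integral_nonneg (hnn n x))).symm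
    simp only [h3]
    rw [← ENNReal.rpow_le_rpow_iff (z := p.toReal⁻¹) (by positivity),
      ← ENNReal.rpow_mul, mul_inv_cancel₀ hpr.ne', ENNReal.rpow_one, ← one_div,
      ← eLpNorm_eq_lintegral_rpow_enorm_toReal hp0 hp]
    exact hJB n
  filter_upwards [ae_lt_top (Measurable.iSup fun n =>
    ((hJc n).measurable.ennreal_ofReal).pow_const _) hfin.ne] with x hx
  have h4 : (⨆ n, ENNReal.ofReal (J n x)) ^ p.toReal = ⨆ n, ENNReal.ofReal (J n x) ^ p.toReal :=
    (ENNReal.orderIsoRpow p.toReal hpr).map_iSup _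
  rw [← h4] at hx
  exact (ENNReal.rpow_lt_top_iff_of_pos hpr).1 hx

variable {𝕜 E : Type*} [RCLike 𝕜] [NormedAddCommGroup E] [NormedSpace 𝕜 E] [NormedSpace ℝ E]
  [SMulCommClass ℝ 𝕜 E] [CompleteSpace E]

/-- Young's inequality in pointwise form: for integrable `k` and `g` in `L^p` the convolution
integral converges absolutely almost everywhere, and it represents the Bochner integral of the
translates of `g`. As Haar measure need not be `σ`-finite, nor multiplication jointly measurable,
Fubini's theorem is not available for `k` and `g` directly: both are approximated rapidly by
compactly supported continuous functions, and a dominating sequence controls the limit. -/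
theorem ae_integrable_and_integratedForm_leftRegular_eq (hp : p ≠ ∞) {k : G → 𝕜}
    (hk : Integrable k ν) (g : Lp E p ν) :
    ∀ᵐ x ∂ν, Integrable (fun y => k y • g (y⁻¹ * x)) ν ∧
      integratedForm ν (leftRegular ν 𝕜 E p) (continuous_leftRegular hp) bounded_leftRegular k hk g
        x = ∫ y, k y • g (y⁻¹ * x) ∂ν := by
  have hp1 : 1 ≤ p := Fact.out
  obtain ⟨kn, hkc, hks, hkm, hkn, hkae⟩ :=
    (memLp_one_iff_integrable.2 hk).exists_seq_hasCompactSupport le_rfl (by simp)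
  obtain ⟨gn, hgc, hgs, hgm, hgn, hgae⟩ := (Lp.memLp g).exists_seq_hasCompactSupport hp1 hp
  obtain ⟨K, hKc, hKs, hKm, hKk, A, hA, hKA⟩ := exists_monotone_dominating le_rfl
    (memLp_one_iff_integrable.2 hk) hkc hks hkm hkn
  obtain ⟨D, hDc, hDs, hDm, hDg, B, hB, hDB⟩ := exists_monotone_dominating hp1
    (Lp.memLp g) hgc hgs hgm hgn
  have hK0 : ∀ n x, 0 ≤ K n x := fun n x => (norm_nonneg _).trans (hKk n x)
  have hD0 : ∀ n x, 0 ≤ D n x := fun n x => (norm_nonneg _).trans (hDg n x)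
  have hki : ∀ n, Integrable (kn n) ν := fun n => memLp_one_iff_integrable.1 (hkm n)
  let T : (l : G → 𝕜) → Integrable l ν → Lp E p ν →L[𝕜] Lp E p ν := fun l hl =>
    integratedForm ν (leftRegular ν 𝕜 E p) (continuous_leftRegular hp) bounded_leftRegular l hl
  have hT : ∀ (l : G → 𝕜) (hl : Integrable l ν) (h : Lp E p ν),
      ‖T l hl h‖ ≤ (∫ x, ‖l x‖ ∂ν) * ‖h‖ := fun l hl h => by
    simpa using norm_integratedForm_apply_le (hc := continuous_leftRegular hp)
      (hb := bounded_leftRegular) (hk := hl) (norm_leftRegular_le (ν := ν) (𝕜 := 𝕜) (E := E)) h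
  have hpow : Tendsto (fun n : ℕ => (2⁻¹ : ℝ≥0∞) ^ n) atTop (𝓝 0) :=
    ENNReal.tendsto_pow_atTop_nhds_zero_of_lt_one (by simp)
  -- The operators converge along the two approximating sequences.
  have hgLp : Tendsto (fun n => (hgm n).toLp (gn n)) atTop (𝓝 g) := by
    rw [Lp.tendsto_Lp_iff_tendsto_eLpNorm']
    refine tendsto_of_tendsto_of_tendsto_of_le_of_le tendsto_const_nhds hpow (fun _ => zero_le)
      fun n => ?_
    rw [eLpNorm_congr_ae ((hgm n).coeFn_toLp.sub (ae_eq_refl g)), eLpNorm_sub_comm]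
    exact hgn n
  have hkL1 : Tendsto (fun n => ∫ x, ‖kn n x - k x‖ ∂ν) atTop (𝓝 0) := by
    have h1 : ∀ n, ∫ x, ‖kn n x - k x‖ ∂ν = (eLpNorm (k - kn n) 1 ν).toReal := fun n => by
      rw [eLpNorm_sub_comm, eLpNorm_one_eq_lintegral_enorm,
        ← ofReal_integral_norm_eq_lintegral_enorm ((hki n).sub hk),
        ENNReal.toReal_ofReal (by positivity)]
      rfl
    simp only [h1]
    rw [← ENNReal.toReal_zero, ENNReal.tendsto_toReal_iff
      (fun n => ((memLp_one_iff_integrable.2 hk).sub (hkm n)).2.ne) (by simp)]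
    exact tendsto_of_tendsto_of_tendsto_of_le_of_le tendsto_const_nhds hpow (fun _ => zero_le) hkn
  have hlim : Tendsto (fun n => T (kn n) (hki n) ((hgm n).toLp (gn n))) atTop (𝓝 (T k hk g)) := by
    rw [tendsto_iff_norm_sub_tendsto_zero]
    have h0 : Tendsto (fun n => (∫ x, ‖kn n x - k x‖ ∂ν) * ‖(hgm n).toLp (gn n)‖ +
        (∫ x, ‖k x‖ ∂ν) * ‖(hgm n).toLp (gn n) - g‖) atTop (𝓝 0) := by
      have := (hkL1.mul hgLp.norm).add
        ((tendsto_iff_norm_sub_tendsto_zero.1 hgLp).const_mul (∫ x, ‖k x‖ ∂ν))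
      simpa using this
    refine squeeze_zero (fun _ => norm_nonneg _) (fun n => ?_) h0
    have h2 : T (kn n) (hki n) ((hgm n).toLp (gn n)) - T k hk g =
        T (kn n - k) ((hki n).sub hk) ((hgm n).toLp (gn n)) +
          T k hk ((hgm n).toLp (gn n) - g) := by
      rw [map_sub]
      simp only [T]
      rw [integratedForm_sub (hk := hki n) (hl := hk)]
      abel
    rw [h2]
    exact (norm_add_le _ _).trans (add_le_add (hT _ _ _) (hT _ _ _))
  obtain ⟨ns, hns, hae⟩ := (tendstoInMeasure_of_tendsto_Lp hlim).exists_seq_tendsto_ae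
  have hpt : ∀ᵐ x ∂ν, ∀ n, T (kn n) (hki n) ((hgm n).toLp (gn n)) x =
      ∫ y, kn n y • gn n (y⁻¹ * x) ∂ν := ae_all_iff.2 fun n =>
    integratedForm_leftRegular_toLp hp (hkc n) (hks n) (hki n) (hgc n) (hgs n) (hgm n)
  filter_upwards [hae, hpt, ae_iSup_lintegral_mul_inv_mul_lt_top hp hKc hKs hKm hK0 hA hKA hDc hDs
    hDm hD0 hB hDB] with x hx1 hx2 hx3
  have hmeas : ∀ n, Measurable fun y => ENNReal.ofReal (K n y * D n (y⁻¹ * x)) := fun n =>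
    ((hKc n).mul ((hDc n).comp (continuous_inv.mul continuous_const))).measurable.ennreal_ofReal
  rw [← lintegral_iSup hmeas fun m n hmn y => ENNReal.ofReal_le_ofReal
    (mul_le_mul (hKm _ hmn) (hDm _ hmn) (hD0 _ _) (hK0 _ _))] at hx3
  let b : G → ℝ≥0∞ := fun y => ⨆ n, ENNReal.ofReal (K n y * D n (y⁻¹ * x))
  have hbm : Measurable b := Measurable.iSup hmeas
  have hbi : Integrable (fun y => (b y).toReal) ν :=
    integrable_toReal_of_lintegral_ne_top hbm.aemeasurable hx3.ne
  have hbound : ∀ᵐ y ∂ν, ∀ n, ‖kn n y • gn n (y⁻¹ * x)‖ ≤ (b y).toReal := by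
    filter_upwards [ae_lt_top hbm hx3.ne] with y hy n
    rw [norm_smul]
    refine (mul_le_mul (hKk n y) (hDg n _) (norm_nonneg _) (hK0 n y)).trans ?_
    rw [← ENNReal.ofReal_le_iff_le_toReal hy.ne]
    exact le_iSup (fun n => ENNReal.ofReal (K n y * D n (y⁻¹ * x))) n
  -- Off the supports of the `kn` the function `k` vanishes; on each of these compact sets the
  -- points `y⁻¹ x` avoid the exceptional null set of `gn → g`.
  have hptlim : ∀ᵐ y ∂ν, Tendsto (fun n => kn n y • gn n (y⁻¹ * x)) atTop
      (𝓝 (k y • g (y⁻¹ * x))) := by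
    have h5 : ∀ᵐ y ∂ν, ∀ n, y ∈ tsupport (kn n) →
        Tendsto (fun n => gn n (y⁻¹ * x)) atTop (𝓝 (g (y⁻¹ * x))) :=
      ae_all_iff.2 fun n => ae_mem_imp_inv_mul_of_isCompact hgae (hks n) x
    filter_upwards [hkae, h5] with y hy1 hy2
    by_cases hy : ∃ n, y ∈ tsupport (kn n)
    · exact hy1.smul (hy2 _ hy.choose_spec)
    · push Not at hy
      have h6 : ∀ n, kn n y = 0 := fun n => image_eq_zero_of_notMem_tsupport (hy n)
      have h7 : k y = 0 := tendsto_nhds_unique hy1 (by simp [h6])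
      simp [h6, h7]
  have hms : ∀ n, AEStronglyMeasurable (fun y => kn n y • gn n (y⁻¹ * x)) ν := fun n =>
    (((hkc n).smul ((hgc n).comp (continuous_inv.mul
      continuous_const))).stronglyMeasurable_of_hasCompactSupport
        (hks n).smul_right).aestronglyMeasurable
  refine ⟨?_, ?_⟩
  · refine hbi.mono' (aestronglyMeasurable_of_tendsto_ae _ hms hptlim) ?_
    filter_upwards [hbound, hptlim] with y hy1 hy2
    exact le_of_tendsto' hy2.norm hy1
  · have h8 := tendsto_integral_of_dominated_convergence _ hms hbi
      (fun n => hbound.mono fun y hy => hy n) hptlim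
    refine tendsto_nhds_unique hx1 ?_
    simp only [hx2]
    exact h8.comp hns.tendsto_atTop

end ConvolutionOperator

section Existence

variable {G : Type*} [TopologicalSpace G] [Group G] [IsTopologicalGroup G]
    [LocallyCompactSpace G] [T2Space G] [MeasurableSpace G] [BorelSpace G]
    {ν : Measure G} [IsHaarMeasure ν] [Regular ν] {p : ℝ≥0∞} [Fact (1 ≤ p)]

theorem isConvolutionOperator_integratedForm (hp : p ≠ ∞) {k : G → ℂ} (hk : Integrable k ν) :
    IsConvolutionOperator ν p k (integratedForm ν (leftRegular ν ℂ ℂ p)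
      (continuous_leftRegular hp) bounded_leftRegular k hk) :=
  fun g => ae_integrable_and_integratedForm_leftRegular_eq hp hk g

end Existence

theorem IsConvolutionOperator.unique {G : Type*} [Group G] [MeasurableSpace G] {ν : Measure G}
    {p : ℝ≥0∞} [Fact (1 ≤ p)] {k : G → ℂ} {S T : Lp ℂ p ν →L[ℂ] Lp ℂ p ν}
    (hS : IsConvolutionOperator ν p k S) (hT : IsConvolutionOperator ν p k T) : S = T := by
  ext1 g
  apply Lp.ext
  filter_upwards [hS g, hT g] with x h1 h2
  rw [h1.2, h2.2]

/-! ### Invariant means and averages -/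

section IntegratedFormL1

variable {G : Type*} [TopologicalSpace G] [Group G] [IsTopologicalGroup G]
    [LocallyCompactSpace G] [MeasurableSpace G] [BorelSpace G]
    {ν : Measure G} [IsHaarMeasure ν] [Regular ν] {𝕜 E : Type*} [RCLike 𝕜]
    [NormedAddCommGroup E] [NormedSpace 𝕜 E] [NormedSpace ℝ E] [SMulCommClass ℝ 𝕜 E]

variable (ν) in
/-- For a fixed vector `f`, the map `k ↦ ∫ k(x) π(x) f dν(x)` on `L¹(G)`. -/
noncomputable def integratedFormL1 (π : G →* (E →L[𝕜] E)) (hc : ∀ f, Continuous fun x => π x f)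
    (hb : ∃ B : ℝ, ∀ x, ‖π x‖ ≤ B) (f : E) : Lp 𝕜 1 ν →L[𝕜] E :=
  LinearMap.mkContinuousOfExistsBound
    { toFun := fun k => ∫ x, k x • π x f ∂ν
      map_add' := fun k l => by
        rw [← integral_add (integrable_smul_rep (L1.integrable_coeFn k) hc hb f)
          (integrable_smul_rep (L1.integrable_coeFn l) hc hb f)]
        refine integral_congr_ae ?_
        filter_upwards [Lp.coeFn_add k l] with x hx
        rw [hx, Pi.add_apply, add_smul]
      map_smul' := fun c k => by
        rw [RingHom.id_apply, ← integral_smul]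
        refine integral_congr_ae ?_
        filter_upwards [Lp.coeFn_smul c k] with x hx
        rw [hx, Pi.smul_apply, smul_assoc] }
    (by
      obtain ⟨B, hB⟩ := hb
      refine ⟨B * ‖f‖, fun k => (norm_integral_smul_rep_le _ (L1.integrable_coeFn k) hB f).trans ?_⟩
      rw [L1.norm_eq_integral_norm]
      exact le_of_eq (by ring))

variable {π : G →* (E →L[𝕜] E)} {hc : ∀ f, Continuous fun x => π x f}
  {hb : ∃ B : ℝ, ∀ x, ‖π x‖ ≤ B}

theorem integratedFormL1_apply (f : E) (k : Lp 𝕜 1 ν) :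
    integratedFormL1 ν π hc hb f k = ∫ x, k x • π x f ∂ν := rfl

theorem integratedFormL1_toLp (f : E) {k : G → 𝕜} (hk : MemLp k 1 ν) :
    integratedFormL1 ν π hc hb f (hk.toLp k) = ∫ x, k x • π x f ∂ν := by
  rw [integratedFormL1_apply]
  refine integral_congr_ae ?_
  filter_upwards [hk.coeFn_toLp] with x hx
  rw [hx]

theorem norm_integratedFormL1_le {B : ℝ} (hB : ∀ x, ‖π x‖ ≤ B) (f : E) (k : Lp 𝕜 1 ν) :
    ‖integratedFormL1 ν π hc hb f k‖ ≤ B * ‖k‖ * ‖f‖ := by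
  rw [L1.norm_eq_integral_norm]
  exact norm_integral_smul_rep_le _ (L1.integrable_coeFn k) hB f

/-- `k ↦ ∫ k(x) π(x) f dν(x)` intertwines left translation with `π`. -/
theorem integratedFormL1_leftRegular [CompleteSpace E] (f : E) (z : G) (k : Lp 𝕜 1 ν) :
    integratedFormL1 ν π hc hb f (leftRegular ν 𝕜 𝕜 1 z k) =
      π z (integratedFormL1 ν π hc hb f k) := by
  rw [integratedFormL1_apply, integratedFormL1_apply, ← ContinuousLinearMap.integral_comp_comm _
    (integrable_smul_rep (L1.integrable_coeFn k) hc hb f)]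
  have h1 : ∫ x, leftRegular ν 𝕜 𝕜 1 z k x • π x f ∂ν = ∫ x, k (z⁻¹ * x) • π x f ∂ν := by
    refine integral_congr_ae ?_
    filter_upwards [leftRegular_coeFn (𝕜 := 𝕜) z k] with x hx
    rw [hx]
  rw [h1, ← integral_mul_left_eq_self _ z]
  congr 1 with x
  simp

end IntegratedFormL1

section Mean

variable {G : Type*} [TopologicalSpace G] [Group G] [IsTopologicalGroup G]
    [LocallyCompactSpace G] [T2Space G] [MeasurableSpace G] [BorelSpace G]
    (ν : Measure G) [IsHaarMeasure ν] [Regular ν]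

/-- The bounded continuous function `x ↦ ∫ k(y) g(y⁻¹ x) dν(y)`. -/
noncomputable def convolutionBCF {k : G → ℝ} (hk : Continuous k) (hks : HasCompactSupport k)
    (g : G →ᵇ ℝ) : G →ᵇ ℝ :=
  BoundedContinuousFunction.ofNormedAddCommGroup (fun x => ∫ y, k y • g (y⁻¹ * x) ∂ν)
    (continuous_integral_mul_inv_mul hk hks g.continuous) (∫ y, ‖k y‖ * ‖g‖ ∂ν) fun x => by
      refine norm_integral_le_of_norm_le
        ((hk.integrable_of_hasCompactSupport hks).norm.mul_const _) (ae_of_all _ fun y => ?_)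
      rw [norm_smul]
      gcongr
      exact g.norm_coe_le_norm _

theorem integrable_smul_comp_inv_mul {k : G → ℝ} (hk : Continuous k) (hks : HasCompactSupport k)
    (g : G →ᵇ ℝ) (x : G) : Integrable (fun y => k y • g (y⁻¹ * x)) ν :=
  Continuous.integrable_of_hasCompactSupport
    (hk.smul (g.continuous.comp (continuous_inv.mul continuous_const))) hks.smul_right

open scoped CompactlySupported

/-- For `g ≥ 0` the functional `k ↦ M(k * g)` is positive and left invariant, so it is a multiple
of the Haar integral. -/
theorem exists_mean_convolutionBCF_of_nonneg {M : (G →ᵇ ℝ) →ₗ[ℝ] ℝ}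
    (hM0 : ∀ f : G →ᵇ ℝ, (∀ y, 0 ≤ f y) → 0 ≤ M f)
    (hMinv : ∀ (x : G) (f : G →ᵇ ℝ),
      M (f.compContinuous ⟨fun y => x * y, continuous_const_mul x⟩) = M f)
    (g : G →ᵇ ℝ) (hg : ∀ x, 0 ≤ g x) :
    ∃ c : ℝ, ∀ (k : G → ℝ) (hk : Continuous k) (hks : HasCompactSupport k),
      M (convolutionBCF ν hk hks g) = c * ∫ y, k y ∂ν := by
  let Λ : C_c(G, ℝ) →ₚ[ℝ] ℝ := PositiveLinearMap.mk₀
    { toFun := fun k => M (convolutionBCF ν k.continuous k.hasCompactSupport g)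
      map_add' := fun k l => by
        rw [← map_add]
        congr 1
        ext x
        refine Eq.trans ?_ (integral_add
          (integrable_smul_comp_inv_mul ν k.continuous k.hasCompactSupport g x)
          (integrable_smul_comp_inv_mul ν l.continuous l.hasCompactSupport g x))
        refine integral_congr_ae (ae_of_all _ fun y => ?_)
        exact add_smul _ _ _
      map_smul' := fun c k => by
        rw [← map_smul]
        congr 1
        ext x
        refine Eq.trans ?_ (integral_smul c _)
        refine integral_congr_ae (ae_of_all _ fun y => ?_)
        exact smul_assoc c (k y) (g (y⁻¹ * x)) }
    fun k hk => hM0 _ fun x => integral_nonneg fun y => mul_nonneg (hk y) (hg _)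
  have hΛ : ∀ k : C_c(G, ℝ), Λ k = M (convolutionBCF ν k.continuous k.hasCompactSupport g) :=
    fun k => rfl
  let μ' := RealRMK.rieszMeasure Λ
  have hinv : IsMulLeftInvariant μ' := by
    refine ⟨fun z => ?_⟩
    have : Regular (map (z * ·) μ') := Regular.map (Homeomorph.mulLeft z)
    refine ext_of_integral_eq_on_compactlySupported fun f => ?_
    let f' : C_c(G, ℝ) := ⟨⟨fun y => f (z * y), by fun_prop⟩,
      f.hasCompactSupport.comp_homeomorph (Homeomorph.mulLeft z)⟩
    have h1 : ∫ x, f x ∂(map (z * ·) μ') = ∫ x, f' x ∂μ' :=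
      integral_map (continuous_const_mul z).measurable.aemeasurable
        (f.continuous.stronglyMeasurable_of_hasCompactSupport
          f.hasCompactSupport).aestronglyMeasurable
    rw [h1, RealRMK.integral_rieszMeasure, RealRMK.integral_rieszMeasure, hΛ, hΛ,
      ← hMinv z (convolutionBCF ν f.continuous f.hasCompactSupport g)]
    congr 1
    ext x
    change ∫ y, f (z * y) • g (y⁻¹ * x) ∂ν = ∫ y, f y • g (y⁻¹ * (z * x)) ∂ν
    rw [← integral_mul_left_eq_self (fun y => f y • g (y⁻¹ * (z * x))) z]
    simp
  refine ⟨haarScalarFactor μ' ν, fun k hk hks => ?_⟩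
  have h2 := integral_isMulLeftInvariant_eq_smul_of_hasCompactSupport μ' ν hk hks
  rw [integral_smul_nnreal_measure] at h2
  exact (RealRMK.integral_rieszMeasure Λ ⟨⟨k, hk⟩, hks⟩).symm.trans h2

theorem exists_mean_convolutionBCF {M : (G →ᵇ ℝ) →ₗ[ℝ] ℝ}
    (hM0 : ∀ f : G →ᵇ ℝ, (∀ y, 0 ≤ f y) → 0 ≤ M f)
    (hMinv : ∀ (x : G) (f : G →ᵇ ℝ),
      M (f.compContinuous ⟨fun y => x * y, continuous_const_mul x⟩) = M f) (g : G →ᵇ ℝ) :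
    ∃ c : ℝ, ∀ (k : G → ℝ) (hk : Continuous k) (hks : HasCompactSupport k),
      M (convolutionBCF ν hk hks g) = c * ∫ y, k y ∂ν := by
  let a : G →ᵇ ℝ := BoundedContinuousFunction.const G ‖g‖
  obtain ⟨c, h⟩ := exists_mean_convolutionBCF_of_nonneg ν hM0 hMinv (g + a) fun x => by
    have := g.norm_coe_le_norm x
    rw [Real.norm_eq_abs] at this
    simpa [a, neg_le_iff_add_nonneg] using (abs_le.1 this).1
  obtain ⟨d, h'⟩ := exists_mean_convolutionBCF_of_nonneg ν hM0 hMinv a fun x => norm_nonneg g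
  refine ⟨c - d, fun k hk hks => ?_⟩
  have : convolutionBCF ν hk hks g =
      convolutionBCF ν hk hks (g + a) - convolutionBCF ν hk hks a := by
    ext x
    refine Eq.trans ?_ (integral_sub (integrable_smul_comp_inv_mul ν hk hks _ x)
      (integrable_smul_comp_inv_mul ν hk hks _ x))
    refine integral_congr_ae (ae_of_all _ fun y => ?_)
    simp [mul_add]
  rw [this, map_sub, h, h', sub_mul]

/-- The mean of `x ↦ ∫ κ(y) g(y x) dν(y)` depends on `κ` only through its integral. Here an
inversion turns the average into a convolution. -/
theorem exists_mean_eq_mul_integral {M : (G →ᵇ ℝ) →ₗ[ℝ] ℝ}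
    (hM0 : ∀ f : G →ᵇ ℝ, (∀ y, 0 ≤ f y) → 0 ≤ M f)
    (hMinv : ∀ (x : G) (f : G →ᵇ ℝ),
      M (f.compContinuous ⟨fun y => x * y, continuous_const_mul x⟩) = M f) (g : G →ᵇ ℝ) :
    ∃ c : ℝ, ∀ (κ : G → ℝ), Continuous κ → HasCompactSupport κ →
      ∀ F : G →ᵇ ℝ, (∀ x, F x = ∫ y, κ y * g (y * x) ∂ν) → M F = c * ∫ y, κ y ∂ν := by
  obtain ⟨c, hc⟩ := exists_mean_convolutionBCF ν hM0 hMinv g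
  obtain ⟨w, w_cont, -, hw⟩ := exists_continuous_pos_integral_eq_integral_inv ν
  refine ⟨c, fun κ hκ hκs F hF => ?_⟩
  have hk : Continuous fun y => κ y⁻¹ * w y⁻¹ :=
    (hκ.comp continuous_inv).mul (w_cont.comp continuous_inv)
  have hks : HasCompactSupport fun y => κ y⁻¹ * w y⁻¹ :=
    HasCompactSupport.mul_right (hκs.comp_homeomorph (Homeomorph.inv G))
  have h1 : F = convolutionBCF ν hk hks g := by
    ext x
    rw [hF, hw (fun y => κ y * g (y * x))
      (hκ.mul (g.continuous.comp (continuous_id.mul continuous_const))) hκs.mul_right]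
    refine integral_congr_ae (ae_of_all _ fun y => ?_)
    simp only [smul_eq_mul]
    ring
  rw [h1, hc, ← hw κ hκ hκs]

variable {ν} {E : Type*} [NormedAddCommGroup E] [NormedSpace ℝ E] [CompleteSpace E]

/-- Day's convexity argument. If no vector of `C` were moved to nearly the same place by all the
averages over the `κ i`, a separating functional would give a function on `G` that is bounded below
by a positive constant but has mean zero. -/
theorem exists_norm_integratedForm_sub_lt (hG : IsAmenableGroup G) {π : G →* (E →L[ℝ] E)}
    (hc : ∀ f, Continuous fun x => π x f) (hb : ∃ B : ℝ, ∀ x, ‖π x‖ ≤ B) {C : Set E}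
    (hC : Convex ℝ C) (hCne : C.Nonempty) (hCπ : ∀ x, ∀ h ∈ C, π x h ∈ C) {ι : Type*} [Fintype ι]
    {κ₀ : G → ℝ} (hκ₀ : Continuous κ₀) (hκ₀s : HasCompactSupport κ₀) (hκ₀i : Integrable κ₀ ν)
    {κ : ι → G → ℝ}
    (hκ : ∀ i, Continuous (κ i)) (hκs : ∀ i, HasCompactSupport (κ i))
    (hκi : ∀ i, Integrable (κ i) ν) (hκκ : ∀ i, ∫ y, κ i y ∂ν = ∫ y, κ₀ y ∂ν)
    {ε : ℝ} (hε : 0 < ε) :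
    ∃ h ∈ C, ∀ i, ‖integratedForm ν π hc hb (κ i) (hκi i) h -
      integratedForm ν π hc hb κ₀ hκ₀i h‖ < ε := by
  classical
  obtain ⟨M, hM0, hM1, hMinv⟩ := hG
  obtain ⟨B, hB⟩ := hb
  have hb : ∃ B : ℝ, ∀ x, ‖π x‖ ≤ B := ⟨B, hB⟩
  let Φ : E →L[ℝ] (ι → E) := ContinuousLinearMap.pi fun i =>
    integratedForm ν π hc hb (κ i) (hκi i) - integratedForm ν π hc hb κ₀ hκ₀i
  by_cases h0 : (0 : ι → E) ∈ closure (Φ '' C)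
  · obtain ⟨_, ⟨h, hh, rfl⟩, hlt⟩ := Metric.mem_closure_iff.1 h0 ε hε
    refine ⟨h, hh, fun i => ?_⟩
    rw [dist_eq_norm, zero_sub, norm_neg] at hlt
    exact (norm_le_pi_norm (Φ h) i).trans_lt hlt
  obtain ⟨L, u, hu0, hu⟩ := geometric_hahn_banach_point_closed
    ((hC.linear_image Φ.toLinearMap).closure) isClosed_closure h0
  rw [map_zero] at hu0
  obtain ⟨h₀, hh₀⟩ := hCne
  -- The matrix coefficient of a functional along the orbit of `h₀`.
  let coeff : (E →L[ℝ] ℝ) → (G →ᵇ ℝ) := fun l =>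
    BoundedContinuousFunction.ofNormedAddCommGroup (fun x => l (π x h₀))
      (l.continuous.comp (hc h₀)) (‖l‖ * (B * ‖h₀‖)) fun x => by
        refine (l.le_opNorm _).trans ?_
        gcongr
        exact (π x).le_of_opNorm_le (hB x) h₀
  have hcoeff : ∀ l x, coeff l x = l (π x h₀) := fun l x => rfl
  let Λ : ι → E →L[ℝ] ℝ := fun i => L.comp (ContinuousLinearMap.single ℝ (fun _ : ι => E) i)
  -- The mean of the coefficient of an averaged functional sees only the integral of the weight, so
  -- the mean of the coefficient of `L ∘ Φ` vanishes, although that coefficient is at least `u > 0`.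
  have hmean : ∀ i, ∃ c : ℝ, ∀ (k : G → ℝ) (hk : Integrable k ν), Continuous k →
      HasCompactSupport k →
      M (coeff ((Λ i).comp (integratedForm ν π hc hb k hk))) = c * ∫ y, k y ∂ν := by
    intro i
    obtain ⟨c, hc'⟩ := exists_mean_eq_mul_integral ν hM0 hMinv (coeff (Λ i))
    refine ⟨c, fun k hk hkc hks => hc' k hkc hks _ fun x => ?_⟩
    rw [hcoeff, ContinuousLinearMap.comp_apply, integratedForm_apply,
      ← ContinuousLinearMap.integral_comp_comm _ (integrable_smul_rep hk hc hb _)]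
    congr 1 with y
    rw [map_smul, hcoeff, map_mul, smul_eq_mul]
    rfl
  have hF : coeff (L.comp Φ) = ∑ i, (coeff ((Λ i).comp (integratedForm ν π hc hb (κ i) (hκi i))) -
      coeff ((Λ i).comp (integratedForm ν π hc hb κ₀ hκ₀i))) := by
    ext x
    rw [BoundedContinuousFunction.coe_sum, Finset.sum_apply]
    have h1 : Φ (π x h₀) = ∑ i, Pi.single i (Φ (π x h₀) i) :=
      (Finset.univ_sum_single _).symm
    rw [hcoeff, ContinuousLinearMap.comp_apply, h1, _root_.map_sum]
    refine Finset.sum_congr rfl fun i _ => ?_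
    rw [BoundedContinuousFunction.sub_apply, hcoeff, hcoeff]
    exact map_sub (Λ i) (integratedForm ν π hc hb (κ i) (hκi i) (π x h₀))
      (integratedForm ν π hc hb κ₀ hκ₀i (π x h₀))
  have hMF : M (coeff (L.comp Φ)) = 0 := by
    rw [hF, _root_.map_sum]
    refine Finset.sum_eq_zero fun i _ => ?_
    obtain ⟨c, hc'⟩ := hmean i
    rw [map_sub, hc' _ _ (hκ i) (hκs i), hc' _ _ hκ₀ hκ₀s, hκκ, sub_self]
  have hpos := hM0 (coeff (L.comp Φ) - u • BoundedContinuousFunction.const G 1) fun x => by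
    have := hu _ (subset_closure ⟨_, hCπ x h₀ hh₀, rfl⟩)
    simpa [hcoeff] using this.le
  rw [map_sub, map_smul, hM1, hMF, smul_eq_mul] at hpos
  linarith

end Mean

/-! ### Reiter's condition -/

section AlmostInvariant

variable {G : Type*} [TopologicalSpace G] [Group G] [IsTopologicalGroup G]
    [LocallyCompactSpace G] [T2Space G] [MeasurableSpace G] [BorelSpace G]
    {ν : Measure G} [IsHaarMeasure ν] [Regular ν]

variable (ν) in
theorem exists_continuous_nonneg_integral_eq_one :
    ∃ κ : G → ℝ, Continuous κ ∧ HasCompactSupport κ ∧ (∀ x, 0 ≤ κ x) ∧ ∫ x, κ x ∂ν = 1 := by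
  obtain ⟨⟨g, g_cont⟩, g_comp, g_nonneg, g_one⟩ :
    ∃ (g : C(G, ℝ)), HasCompactSupport g ∧ 0 ≤ g ∧ g 1 ≠ 0 := exists_continuous_nonneg_pos 1
  have hpos : 0 < ∫ x, g x ∂ν :=
    g_cont.integral_pos_of_hasCompactSupport_nonneg_nonzero g_comp g_nonneg g_one
  refine ⟨fun x => (∫ x, g x ∂ν)⁻¹ * g x, continuous_const.mul g_cont, g_comp.mul_left,
    fun x => mul_nonneg (inv_nonneg.2 hpos.le) (g_nonneg x), ?_⟩
  rw [integral_const_mul, inv_mul_cancel₀ hpos.ne']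

variable {E : Type*} [NormedAddCommGroup E] [NormedSpace ℝ E] [CompleteSpace E]

theorem integratedForm_mem_of_convex {π : G →* (E →L[ℝ] E)}
    (hc : ∀ f, Continuous fun x => π x f) (hb : ∃ B : ℝ, ∀ x, ‖π x‖ ≤ B) {C : Set E}
    (hC : Convex ℝ C) (hCc : IsClosed C) (hCπ : ∀ x, ∀ h ∈ C, π x h ∈ C) {κ : G → ℝ}
    (hκ : Continuous κ) (hκi : Integrable κ ν) (hκ0 : ∀ x, 0 ≤ κ x) (hκ1 : ∫ x, κ x ∂ν = 1)
    {h : E} (hh : h ∈ C) : integratedForm ν π hc hb κ hκi h ∈ C := by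
  let κ' : G → NNReal := fun x => (κ x).toNNReal
  have hκ' : Measurable κ' := hκ.measurable.real_toNNReal
  have hsmul : ∀ x, κ' x • π x h = κ x • π x h := fun x => by
    rw [NNReal.smul_def, Real.coe_toNNReal _ (hκ0 x)]
  have hprob : IsProbabilityMeasure (ν.withDensity fun x => κ' x) := by
    refine ⟨?_⟩
    rw [withDensity_apply _ MeasurableSet.univ, setLIntegral_univ]
    change ∫⁻ x, ENNReal.ofReal (κ x) ∂ν = 1
    rw [← ofReal_integral_eq_lintegral_ofReal hκi (ae_of_all _ hκ0), hκ1, ENNReal.ofReal_one]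
  have key : ∫ x, π x h ∂(ν.withDensity fun x => κ' x) = integratedForm ν π hc hb κ hκi h := by
    rw [integral_withDensity_eq_integral_smul hκ', integratedForm_apply]
    simp only [hsmul]
  rw [← key]
  refine hC.integral_mem hCc (ae_of_all _ fun x => hCπ x h hh) ?_
  rw [integrable_withDensity_iff_integrable_smul hκ']
  simp only [hsmul]
  exact integrable_smul_rep hκi hc hb h

/-- Almost invariant vectors: averaging over a fixed density makes the finitely many approximate
invariances of `exists_norm_integratedForm_sub_lt` uniform on compact sets. -/
theorem exists_norm_sub_le_of_isCompact (hG : IsAmenableGroup G) (ν : Measure G) [IsHaarMeasure ν]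
    [Regular ν] {π : G →* (E →L[ℝ] E)}
    (hc : ∀ f, Continuous fun x => π x f) (hb : ∃ B : ℝ, ∀ x, ‖π x‖ ≤ B) {C : Set E}
    (hC : Convex ℝ C) (hCc : IsClosed C) (hCne : C.Nonempty) (hCπ : ∀ x, ∀ h ∈ C, π x h ∈ C)
    {R : ℝ} (hR : ∀ h ∈ C, ‖h‖ ≤ R) {K : Set G} (hK : IsCompact K) {ε : ℝ} (hε : 0 < ε) :
    ∃ h ∈ C, ∀ z ∈ K, ‖π z h - h‖ ≤ ε := by
  obtain ⟨B, hB⟩ := hb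
  have hb : ∃ B : ℝ, ∀ x, ‖π x‖ ≤ B := ⟨B, hB⟩
  have hB0 : 0 ≤ B := (norm_nonneg _).trans (hB 1)
  have hR0 : 0 ≤ R := (norm_nonneg _).trans (hR _ hCne.some_mem)
  obtain ⟨κ, hκ, hκs, hκ0, hκ1⟩ := exists_continuous_nonneg_integral_eq_one ν
  have hκi : Integrable κ ν := hκ.integrable_of_hasCompactSupport hκs
  have hκm : MemLp κ 1 ν := memLp_one_iff_integrable.2 hκi
  let δ : ℝ := ε / 2 / (B * R + 1)
  have hδ : 0 < δ := by positivity
  have hcont := continuous_leftRegular (ν := ν) (𝕜 := ℝ) (E := ℝ) ENNReal.one_ne_top (hκm.toLp κ)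
  -- The translates of `κ` by `K` are totally bounded in `L¹`, so finitely many of them suffice.
  obtain ⟨t, -, ht⟩ := hK.elim_nhds_subcover
    (fun y => {z | ‖leftRegular ν ℝ ℝ 1 z (hκm.toLp κ) - leftRegular ν ℝ ℝ 1 y (hκm.toLp κ)‖ < δ})
    fun y _ => by
      have := Metric.tendsto_nhds.1 (hcont.tendsto y) δ hδ
      simp only [dist_eq_norm] at this
      exact this
  have htr : ∀ y : G, Continuous (fun x => κ (y⁻¹ * x)) ∧
      HasCompactSupport (fun x => κ (y⁻¹ * x)) := fun y =>
    ⟨hκ.comp (continuous_const_mul _), hκs.comp_homeomorph (Homeomorph.mulLeft y⁻¹)⟩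
  have htri : ∀ y : G, Integrable (fun x => κ (y⁻¹ * x)) ν := fun y =>
    (htr y).1.integrable_of_hasCompactSupport (htr y).2
  obtain ⟨h, hh, hlt⟩ := exists_norm_integratedForm_sub_lt (ι := t) hG hc hb hC hCne hCπ hκ hκs
    hκi (fun y => (htr y).1) (fun y => (htr y).2) (fun y => htri y)
    (fun y => integral_mul_left_eq_self κ _) (half_pos hε)
  refine ⟨integratedForm ν π hc hb κ hκi h,
    integratedForm_mem_of_convex hc hb hC hCc hCπ hκ hκi hκ0 hκ1 hh, fun z hz => ?_⟩
  have hL : ∀ y : G, integratedForm ν π hc hb (fun x => κ (y⁻¹ * x)) (htri y) h =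
      integratedFormL1 ν π hc hb h (leftRegular ν ℝ ℝ 1 y (hκm.toLp κ)) := fun y => by
    rw [integratedForm_apply, integratedFormL1_apply]
    refine integral_congr_ae ?_
    filter_upwards [leftRegular_toLp_coeFn (𝕜 := ℝ) y hκm] with x hx
    rw [hx]
  have hL1 : integratedForm ν π hc hb κ hκi h = integratedFormL1 ν π hc hb h (hκm.toLp κ) :=
    (integratedFormL1_toLp h hκm).symm
  obtain ⟨y, hy, hzy⟩ := Set.mem_iUnion₂.1 (ht hz)
  have h1 := hlt ⟨y, hy⟩
  rw [hL, hL1] at h1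
  rw [hL1, ← integratedFormL1_leftRegular]
  have h2 : ‖integratedFormL1 ν π hc hb h (leftRegular ν ℝ ℝ 1 z (hκm.toLp κ)) -
      integratedFormL1 ν π hc hb h (leftRegular ν ℝ ℝ 1 y (hκm.toLp κ))‖ ≤ ε / 2 := by
    rw [← map_sub]
    calc _ ≤ B * ‖leftRegular ν ℝ ℝ 1 z (hκm.toLp κ) - leftRegular ν ℝ ℝ 1 y (hκm.toLp κ)‖ *
          ‖h‖ := norm_integratedFormL1_le hB h _
      _ ≤ B * δ * R := by
        gcongr
        · exact le_of_lt hzy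
        · exact hR h hh
      _ = ε / 2 * (B * R / (B * R + 1)) := by simp only [δ]; ring
      _ ≤ ε / 2 * 1 := by
        gcongr
        exact (div_le_one (by positivity)).2 (by linarith)
      _ = ε / 2 := mul_one _
  calc _ ≤ _ := norm_sub_le_norm_sub_add_norm_sub _
        (integratedFormL1 ν π hc hb h (leftRegular ν ℝ ℝ 1 y (hκm.toLp κ))) _
    _ ≤ ε / 2 + ε / 2 := add_le_add h2 h1.le
    _ = ε := add_halves ε

end AlmostInvariant

section Reiter

variable {G : Type*} [TopologicalSpace G] [Group G] [IsTopologicalGroup G]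
    [LocallyCompactSpace G] [T2Space G] [MeasurableSpace G] [BorelSpace G]
    (ν : Measure G) [IsHaarMeasure ν] [Regular ν]

/-- Reiter's condition in `L¹`: the almost invariant vectors are found in the convex set of
probability densities. -/
theorem exists_reiter_L1 (hG : IsAmenableGroup G) {K : Set G} (hK : IsCompact K) {ε : ℝ}
    (hε : 0 < ε) :
    ∃ h : Lp ℝ 1 ν, 0 ≤ h ∧ ‖h‖ = 1 ∧ ∀ z ∈ K, ‖leftRegular ν ℝ ℝ 1 z h - h‖ ≤ ε := by
  let C : Set (Lp ℝ 1 ν) := {h | 0 ≤ h} ∩ {h | ∫ x, h x ∂ν = 1}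
  have hnorm : ∀ h : Lp ℝ 1 ν, 0 ≤ h → ‖h‖ = ∫ x, h x ∂ν := fun h hh => by
    rw [L1.norm_eq_integral_norm]
    refine integral_congr_ae ?_
    filter_upwards [(Lp.coeFn_nonneg h).2 hh] with x hx
    exact Real.norm_of_nonneg hx
  have hint : ∀ h : Lp ℝ 1 ν, ∫ x, h x ∂ν = L1.integralCLM (α := G) (E := ℝ) (μ := ν) h := by
    intro h
    rw [← L1.integral_eq, L1.integral_eq_integral]
  obtain ⟨κ, hκ, hκs, hκ0, hκ1⟩ := exists_continuous_nonneg_integral_eq_one ν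
  have hκm : MemLp κ 1 ν := memLp_one_iff_integrable.2 (hκ.integrable_of_hasCompactSupport hκs)
  have hC : Convex ℝ C := by
    rintro f ⟨hf0, hf1⟩ g ⟨hg0, hg1⟩ a b ha hb hab
    have hsmul : ∀ (c : ℝ) (l : Lp ℝ 1 ν), 0 ≤ c → 0 ≤ l → 0 ≤ c • l := fun c l hc hl => by
      refine (Lp.coeFn_nonneg _).1 ?_
      filter_upwards [Lp.coeFn_smul c l, (Lp.coeFn_nonneg l).2 hl] with x h1 h2
      rw [h1]
      exact mul_nonneg hc h2
    refine ⟨show (0 : Lp ℝ 1 ν) ≤ a • f + b • g from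
      add_nonneg (hsmul a f ha hf0) (hsmul b g hb hg0), ?_⟩
    simp only [Set.mem_ofPred_eq, hint] at hf1 hg1 ⊢
    rw [map_add, map_smul, map_smul, hf1, hg1]
    simpa using hab
  have hCc : IsClosed C := by
    refine (isClosed_le continuous_const continuous_id).inter (isClosed_eq ?_ continuous_const)
    simp only [hint]
    exact ContinuousLinearMap.continuous _
  have hCne : C.Nonempty := by
    refine ⟨hκm.toLp κ, ?_, ?_⟩
    · refine (Lp.coeFn_nonneg _).1 ?_
      filter_upwards [hκm.coeFn_toLp] with x hx
      simpa [hx] using hκ0 x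
    · exact (integral_congr_ae hκm.coeFn_toLp).trans hκ1
  have hCπ : ∀ z, ∀ h ∈ C, leftRegular ν ℝ ℝ 1 z h ∈ C := by
    rintro z h ⟨h0, h1⟩
    refine ⟨(Lp.coeFn_nonneg _).1 ?_, ?_⟩
    · have h2 := (measurePreserving_mul_left ν z⁻¹).quasiMeasurePreserving.ae
        ((Lp.coeFn_nonneg h).2 h0)
      filter_upwards [leftRegular_coeFn (𝕜 := ℝ) z h, h2] with x hx hx2
      rw [hx]
      exact hx2
    · refine (integral_congr_ae (leftRegular_coeFn (𝕜 := ℝ) z h)).trans ?_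
      exact (integral_mul_left_eq_self (fun x => h x) z⁻¹).trans h1
  obtain ⟨h, hh, hlt⟩ := exists_norm_sub_le_of_isCompact hG ν
    (continuous_leftRegular (ν := ν) (𝕜 := ℝ) (E := ℝ) ENNReal.one_ne_top) bounded_leftRegular
    hC hCc hCne hCπ (R := 1) (fun h hh => ((hnorm h hh.1).trans hh.2).le) hK hε
  exact ⟨h, hh.1, (hnorm h hh.1).trans hh.2, hlt⟩

theorem abs_rpow_sub_rpow_rpow_le {a b q : ℝ} (ha : 0 ≤ a) (hb : 0 ≤ b) (hq : 1 ≤ q) :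
    |a ^ q⁻¹ - b ^ q⁻¹| ^ q ≤ |a - b| := by
  wlog hab : b ≤ a generalizing a b
  · rw [abs_sub_comm, abs_sub_comm a]
    exact this hb ha (le_of_not_ge hab)
  have hq0 : 0 < q := by linarith
  have h1 : b ^ q⁻¹ ≤ a ^ q⁻¹ := Real.rpow_le_rpow hb hab (by positivity)
  have h2 : a ^ q⁻¹ ≤ b ^ q⁻¹ + (a - b) ^ q⁻¹ := by
    have := Real.rpow_add_le_add_rpow hb (sub_nonneg.2 hab) (by positivity : 0 ≤ q⁻¹)
      (inv_le_one_of_one_le₀ hq)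
    simpa using this
  rw [abs_of_nonneg (sub_nonneg.2 h1), abs_of_nonneg (sub_nonneg.2 hab)]
  calc (a ^ q⁻¹ - b ^ q⁻¹) ^ q ≤ ((a - b) ^ q⁻¹) ^ q :=
        Real.rpow_le_rpow (sub_nonneg.2 h1) (by linarith) hq0.le
    _ = a - b := Real.rpow_inv_rpow (sub_nonneg.2 hab) hq0.ne'

/-- Reiter's condition in `L^p`, obtained from the one in `L¹` by taking `p`-th roots. -/
theorem exists_reiter_Lp (hG : IsAmenableGroup G) {p : ℝ≥0∞} [Fact (1 ≤ p)] (hp : p ≠ ∞)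
    {K : Set G} (hK : IsCompact K) {ε : ℝ} (hε : 0 < ε) :
    ∃ ψ : Lp ℂ p ν, ‖ψ‖ = 1 ∧ ∀ z ∈ K, ‖leftRegular ν ℂ ℂ p z ψ - ψ‖ ≤ ε := by
  have hp1 : 1 ≤ p := Fact.out
  have hp0 : p ≠ 0 := (one_pos.trans_le hp1).ne'
  set q := p.toReal with hq
  have hq1 : 1 ≤ q := by simpa using ENNReal.toReal_mono hp hp1
  have hq0 : 0 < q := by linarith
  obtain ⟨h, h0, h1, hlt⟩ := exists_reiter_L1 ν hG hK (Real.rpow_pos_of_pos hε q)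
  have hnn : ∀ᵐ x ∂ν, 0 ≤ h x := (Lp.coeFn_nonneg h).2 h0
  let φ : G → ℂ := fun x => ((h x ^ q⁻¹ : ℝ) : ℂ)
  have hφm : AEStronglyMeasurable φ ν :=
    Complex.continuous_ofReal.comp_aestronglyMeasurable
      ((Real.continuous_rpow_const (by positivity)).comp_aestronglyMeasurable
        (Lp.aestronglyMeasurable h))
  -- The `p`-th power of the `L^p` norm is the integral of the `p`-th power.
  have hpow : ∀ f : G → ℂ, eLpNorm f p ν = (∫⁻ x, ‖f x‖ₑ ^ q ∂ν) ^ q⁻¹ := fun f => by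
    rw [eLpNorm_eq_lintegral_rpow_enorm_toReal hp0 hp, one_div]
  have hL1 : ∀ f : Lp ℝ 1 ν, ∫⁻ x, ‖f x‖ₑ ∂ν = ENNReal.ofReal ‖f‖ := fun f => by
    rw [← eLpNorm_one_eq_lintegral_enorm, ← Lp.enorm_def, ofReal_norm]
  have hφn : eLpNorm φ p ν = 1 := by
    have : ∫⁻ x, ‖φ x‖ₑ ^ q ∂ν = ∫⁻ x, ‖h x‖ₑ ∂ν := by
      refine lintegral_congr_ae ?_
      filter_upwards [hnn] with x hx
      rw [← ofReal_norm, ← ofReal_norm, Complex.norm_real, ENNReal.ofReal_rpow_of_nonneg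
        (norm_nonneg _) hq0.le, Real.norm_of_nonneg (Real.rpow_nonneg hx _),
        Real.rpow_inv_rpow hx hq0.ne', Real.norm_of_nonneg hx]
    rw [hpow, this, hL1, h1]
    simp
  have hφ : MemLp φ p ν := ⟨hφm, by rw [hφn]; simp⟩
  refine ⟨hφ.toLp φ, by rw [Lp.norm_toLp, hφn]; simp, fun z hz => ?_⟩
  have hae : leftRegular ν ℂ ℂ p z (hφ.toLp φ) - hφ.toLp φ =ᵐ[ν] fun x => φ (z⁻¹ * x) - φ x := by
    filter_upwards [Lp.coeFn_sub (leftRegular ν ℂ ℂ p z (hφ.toLp φ)) (hφ.toLp φ),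
      leftRegular_toLp_coeFn (𝕜 := ℂ) z hφ, hφ.coeFn_toLp] with x h1 h2 h3
    rw [h1, Pi.sub_apply, h2, h3]
  rw [Lp.norm_def, eLpNorm_congr_ae hae]
  refine ENNReal.toReal_le_of_le_ofReal hε.le ?_
  have hle : ∫⁻ x, ‖φ (z⁻¹ * x) - φ x‖ₑ ^ q ∂ν ≤
      ∫⁻ x, ‖(leftRegular ν ℝ ℝ 1 z h - h : Lp ℝ 1 ν) x‖ₑ ∂ν := by
    refine lintegral_mono_ae ?_
    have h2 := (measurePreserving_mul_left ν z⁻¹).quasiMeasurePreserving.ae hnn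
    filter_upwards [hnn, h2, Lp.coeFn_sub (leftRegular ν ℝ ℝ 1 z h) h,
      leftRegular_coeFn (𝕜 := ℝ) z h] with x hx hx2 hx3 hx4
    rw [hx3, Pi.sub_apply, hx4, ← ofReal_norm, ← ofReal_norm, ENNReal.ofReal_rpow_of_nonneg
      (norm_nonneg _) hq0.le]
    refine ENNReal.ofReal_le_ofReal ?_
    simp only [φ]
    rw [← Complex.ofReal_sub, Complex.norm_real]
    exact abs_rpow_sub_rpow_rpow_le hx2 hx hq1
  calc eLpNorm (fun x => φ (z⁻¹ * x) - φ x) p ν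
      = (∫⁻ x, ‖φ (z⁻¹ * x) - φ x‖ₑ ^ q ∂ν) ^ q⁻¹ := hpow _
    _ ≤ (ENNReal.ofReal (ε ^ q)) ^ q⁻¹ := by
      refine ENNReal.rpow_le_rpow (hle.trans ?_) (by positivity)
      rw [hL1]
      exact ENNReal.ofReal_le_ofReal (hlt z hz)
    _ = ENNReal.ofReal ε := by
      rw [ENNReal.ofReal_rpow_of_nonneg (by positivity) (by positivity),
        Real.rpow_rpow_inv hε.le hq0.ne']

end Reiter

/-! ### Tensoring with the identity of an `L^p`-space -/

section Tensor

variable {G E : Type*} [MeasurableSpace G] (ν : Measure G) [NormedAddCommGroup E] [NormedSpace ℂ E]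
  (p : ℝ≥0∞) [Fact (1 ≤ p)]

/-- The elementary tensor `ψ ⊗ v : x ↦ ψ(x) v` in `L^p(G; E)`, as a bounded operator in `ψ` for
fixed `v`. -/
noncomputable def tensorVec (v : E) : Lp ℂ p ν →L[ℂ] Lp E p ν :=
  (ContinuousLinearMap.toSpanSingleton ℂ v).compLpL p ν

variable {ν p}

theorem tensorVec_coeFn (v : E) (ψ : Lp ℂ p ν) : tensorVec ν p v ψ =ᵐ[ν] fun x => ψ x • v :=
  ContinuousLinearMap.coeFn_compLp _ _

theorem tensorVec_add (v w : E) (ψ : Lp ℂ p ν) :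
    tensorVec ν p (v + w) ψ = tensorVec ν p v ψ + tensorVec ν p w ψ := by
  apply Lp.ext
  filter_upwards [tensorVec_coeFn (v + w) ψ, tensorVec_coeFn v ψ, tensorVec_coeFn w ψ,
    Lp.coeFn_add (tensorVec ν p v ψ) (tensorVec ν p w ψ)] with x h1 h2 h3 h4
  rw [h1, h4, Pi.add_apply, h2, h3, smul_add]

theorem tensorVec_smul (c : ℂ) (v : E) (ψ : Lp ℂ p ν) :
    tensorVec ν p (c • v) ψ = tensorVec ν p v (c • ψ) := by
  apply Lp.ext
  filter_upwards [tensorVec_coeFn (c • v) ψ, tensorVec_coeFn v (c • ψ), Lp.coeFn_smul c ψ]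
    with x h1 h2 h3
  rw [h1, h2, h3, Pi.smul_apply, smul_smul, smul_eq_mul, mul_comm]

/-- The elementary tensor `ψ ⊗ v`, as a bounded operator in `v` for fixed `ψ`. -/
noncomputable def tensorFun (ψ : Lp ℂ p ν) : E →L[ℂ] Lp E p ν :=
  LinearMap.mkContinuous
    { toFun := fun v => tensorVec ν p v ψ
      map_add' := fun v w => tensorVec_add v w ψ
      map_smul' := fun c v => by rw [tensorVec_smul, map_smul, RingHom.id_apply] } ‖ψ‖ fun v => by
    refine (ContinuousLinearMap.norm_compLp_le _ _).trans ?_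
    rw [ContinuousLinearMap.norm_toSpanSingleton, mul_comm]

theorem tensorFun_apply (ψ : Lp ℂ p ν) (v : E) : tensorFun ψ v = tensorVec ν p v ψ := rfl

theorem mem_closure_span_tensorVec (hp : p ≠ ∞) (F : Lp E p ν) :
    F ∈ closure ((Submodule.span ℂ {F | ∃ ψ v, F = tensorVec ν p v ψ} : Submodule ℂ (Lp E p ν)) :
      Set (Lp E p ν)) := by
  rw [← Submodule.topologicalClosure_coe]
  induction F using Lp.induction hp with
  | @indicatorConst c s hs hμs =>
    refine subset_closure (Submodule.subset_span ⟨indicatorConstLp p hs hμs.ne 1, c, ?_⟩)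
    rw [Lp.simpleFunc.coe_indicatorConst]
    apply Lp.ext
    filter_upwards [tensorVec_coeFn c (indicatorConstLp p hs hμs.ne (1 : ℂ)),
      indicatorConstLp_coeFn (hs := hs) (hμs := hμs.ne) (c := (1 : ℂ)) (p := p),
      indicatorConstLp_coeFn (hs := hs) (hμs := hμs.ne) (c := c) (p := p)] with x h1 h2 h3
    rw [h1, h2, h3]
    by_cases hx : x ∈ s <;> simp [hx]
  | add hf hg _ h1 h2 => exact Submodule.add_mem _ h1 h2
  | isClosed => exact Submodule.isClosed_topologicalClosure _

theorem MeasureTheory.Lp.enorm_rpow_toReal (hp : p ≠ ∞) (F : Lp E p ν) :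
    ‖F‖ₑ ^ p.toReal = ∫⁻ x, ‖F x‖ₑ ^ p.toReal ∂ν := by
  have hp0 : p ≠ 0 := (one_pos.trans_le (Fact.out : 1 ≤ p)).ne'
  have hpr : 0 < p.toReal := ENNReal.toReal_pos hp0 hp
  rw [Lp.enorm_def, eLpNorm_eq_lintegral_rpow_enorm_toReal hp0 hp, ← ENNReal.rpow_mul,
    one_div, inv_mul_cancel₀ hpr.ne', ENNReal.rpow_one]

end Tensor

section Amplification

variable {G : Type*} [MeasurableSpace G] {ν : Measure G} {Ω : Type*} [MeasurableSpace Ω]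
  {μ : Measure Ω} {p : ℝ≥0∞} [Fact (1 ≤ p)]

theorem enorm_sum_indicatorConstLp_rpow (hp : p ≠ ∞) {D : Type*} [Fintype D] {B : D → Set Ω}
    (hB : ∀ d, MeasurableSet (B d)) (hμB : ∀ d, μ (B d) ≠ ∞)
    (hdisj : Pairwise (Function.onFun Disjoint B)) (c : D → ℂ) :
    ‖∑ d, c d • indicatorConstLp p (hB d) (hμB d) (1 : ℂ)‖ₑ ^ p.toReal =
      ∑ d, ‖c d‖ₑ ^ p.toReal * μ (B d) := by
  have hp0 : p ≠ 0 := (one_pos.trans_le (Fact.out : 1 ≤ p)).ne'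
  have hpr : 0 < p.toReal := ENNReal.toReal_pos hp0 hp
  have h1 : ∀ᵐ ω ∂μ, ∀ d, (c d • indicatorConstLp p (hB d) (hμB d) (1 : ℂ) : Lp ℂ p μ) ω =
      (B d).indicator (fun _ => c d) ω := ae_all_iff.2 fun d => by
    filter_upwards [Lp.coeFn_smul (c d) (indicatorConstLp p (hB d) (hμB d) (1 : ℂ)),
      indicatorConstLp_coeFn (hs := hB d) (hμs := hμB d) (c := (1 : ℂ)) (p := p)] with ω h2 h3
    rw [h2, Pi.smul_apply, h3]
    by_cases hω : ω ∈ B d <;> simp [hω]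
  rw [Lp.enorm_rpow_toReal hp]
  have h4 : ∀ᵐ ω ∂μ, ‖(∑ d, c d • indicatorConstLp p (hB d) (hμB d) (1 : ℂ) : Lp ℂ p μ) ω‖ₑ ^
      p.toReal = ∑ d, (B d).indicator (fun _ => ‖c d‖ₑ ^ p.toReal) ω := by
    filter_upwards [h1, Lp.coeFn_fun_finsetSum Finset.univ
      fun d => c d • indicatorConstLp p (hB d) (hμB d) (1 : ℂ)] with ω h5 h6
    rw [h6, Finset.sum_congr rfl fun d _ => h5 d]
    by_cases hω : ∃ d, ω ∈ B d
    · obtain ⟨d, hd⟩ := hω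
      have hne : ∀ e, e ≠ d → ω ∉ B e := fun e he h => (hdisj he).le_bot ⟨h, hd⟩
      rw [Finset.sum_eq_single d (fun e _ he => Set.indicator_of_notMem (hne e he) _) (by simp),
        Finset.sum_eq_single d (fun e _ he => Set.indicator_of_notMem (hne e he) _) (by simp)]
      simp [hd]
    · push Not at hω
      simp [hω, hpr]
  rw [lintegral_congr_ae h4, lintegral_finsetSum _ fun d _ => measurable_const.indicator (hB d)]
  refine Finset.sum_congr rfl fun d _ => ?_
  rw [lintegral_indicator_const (hB d)]

/-- Fubini's theorem for finite sums `∑ Ψ_d ⊗ 1_{B_d}` over disjoint sets `B_d`. -/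
theorem enorm_sum_tensorVec_indicatorConstLp_rpow (hp : p ≠ ∞) {D : Type*} [Fintype D]
    {B : D → Set Ω} (hB : ∀ d, MeasurableSet (B d)) (hμB : ∀ d, μ (B d) ≠ ∞)
    (hdisj : Pairwise (Function.onFun Disjoint B)) (Ψ : D → Lp ℂ p ν) :
    ‖∑ d, tensorVec ν p (indicatorConstLp p (hB d) (hμB d) (1 : ℂ)) (Ψ d)‖ₑ ^ p.toReal =
      ∑ d, ‖Ψ d‖ₑ ^ p.toReal * μ (B d) := by
  rw [Lp.enorm_rpow_toReal hp]
  have h1 : ∀ᵐ x ∂ν, ‖(∑ d, tensorVec ν p (indicatorConstLp p (hB d) (hμB d) (1 : ℂ)) (Ψ d) :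
      Lp (Lp ℂ p μ) p ν) x‖ₑ ^ p.toReal = ∑ d, ‖Ψ d x‖ₑ ^ p.toReal * μ (B d) := by
    have h2 : ∀ᵐ x ∂ν, ∀ d, tensorVec ν p (indicatorConstLp p (hB d) (hμB d) (1 : ℂ)) (Ψ d) x =
        Ψ d x • indicatorConstLp p (hB d) (hμB d) (1 : ℂ) :=
      ae_all_iff.2 fun d => tensorVec_coeFn _ _
    filter_upwards [h2, Lp.coeFn_fun_finsetSum Finset.univ
      fun d => tensorVec ν p (indicatorConstLp p (hB d) (hμB d) (1 : ℂ)) (Ψ d)] with x h3 h4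
    rw [h4, Finset.sum_congr rfl fun d _ => h3 d,
      enorm_sum_indicatorConstLp_rpow hp hB hμB hdisj]
  have hm : ∀ d, AEMeasurable (fun x => ‖Ψ d x‖ₑ ^ p.toReal) ν := fun d =>
    (Lp.aestronglyMeasurable (Ψ d)).enorm.pow_const _
  rw [lintegral_congr_ae h1, lintegral_finsetSum' _ fun d _ => (hm d).mul_const _]
  refine Finset.sum_congr rfl fun d _ => ?_
  rw [lintegral_mul_const'' _ (hm d), Lp.enorm_rpow_toReal hp]

/-- Finitely many simple functions are combinations of the indicators of common disjoint sets. -/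
theorem exists_common_indicatorConstLp (hp : p ≠ ∞) {A : Type} [Fintype A] {v : A → Lp ℂ p μ}
    (hv : ∀ a, v a ∈ Lp.simpleFunc ℂ p μ) :
    ∃ (D : Type) (_ : Fintype D) (B : D → Set Ω) (hB : ∀ d, MeasurableSet (B d))
      (hμB : ∀ d, μ (B d) ≠ ∞) (c : A → D → ℂ), Pairwise (Function.onFun Disjoint B) ∧
      ∀ a, v a = ∑ d, c a d • indicatorConstLp p (hB d) (hμB d) (1 : ℂ) := by
  classical
  have hp0 : p ≠ 0 := (one_pos.trans_le (Fact.out : 1 ≤ p)).ne'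
  let s : A → SimpleFunc Ω ℂ := fun a => Lp.simpleFunc.toSimpleFunc ⟨v a, hv a⟩
  have hs : ∀ a, MemLp (s a) p μ := fun a => Lp.simpleFunc.memLp _
  have hsv : ∀ a, s a =ᵐ[μ] v a := fun a => Lp.simpleFunc.toSimpleFunc_eq_toFun ⟨v a, hv a⟩
  -- The joint values of the simple functions; their level sets are the common partition.
  let t : Ω → A → ℂ := fun ω a => s a ω
  have ht : (Set.range t).Finite := by
    refine (Set.Finite.pi' fun a => (s a).finite_range).subset ?_
    rintro _ ⟨ω, rfl⟩ a
    exact ⟨ω, rfl⟩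
  let R : Set (A → ℂ) := Set.range t \ {0}
  have hR : Fintype R := (ht.subset Set.sdiff_subset).fintype
  let B : R → Set Ω := fun d => {ω | t ω = d}
  have hBeq : ∀ d : R, B d = ⋂ a, s a ⁻¹' {(d : A → ℂ) a} := fun d => by
    ext ω
    simp [B, t, funext_iff]
  have hB : ∀ d, MeasurableSet (B d) := fun d => by
    rw [hBeq]
    exact MeasurableSet.iInter fun a => (s a).measurableSet_preimage _
  have hμB : ∀ d, μ (B d) ≠ ∞ := fun d => by
    have hd : (d : A → ℂ) ≠ 0 := d.2.2
    obtain ⟨a, ha⟩ := Function.ne_iff.1 hd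
    refine ne_top_of_le_ne_top
      (SimpleFunc.measure_preimage_lt_top_of_memLp hp0 hp (s a) (hs a) _ ha).ne (measure_mono ?_)
    rw [hBeq]
    exact Set.iInter_subset _ a
  refine ⟨R, hR, B, hB, hμB, fun a d => (d : A → ℂ) a, fun d e hde => ?_, fun a => ?_⟩
  · refine Set.disjoint_left.2 fun ω h1 h2 => hde (Subtype.ext ?_)
    exact Eq.trans (Eq.symm h1) h2
  · apply Lp.ext
    have h1 : ∀ᵐ ω ∂μ, ∀ d : R,
        ((d : A → ℂ) a • indicatorConstLp p (hB d) (hμB d) (1 : ℂ) : Lp ℂ p μ) ω =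
          (B d).indicator (fun _ => (d : A → ℂ) a) ω := ae_all_iff.2 fun d => by
      filter_upwards [Lp.coeFn_smul ((d : A → ℂ) a) (indicatorConstLp p (hB d) (hμB d) (1 : ℂ)),
        indicatorConstLp_coeFn (hs := hB d) (hμs := hμB d) (c := (1 : ℂ)) (p := p)] with ω h2 h3
      rw [h2, Pi.smul_apply, h3]
      by_cases hω : ω ∈ B d <;> simp [hω]
    filter_upwards [h1, hsv a, Lp.coeFn_fun_finsetSum Finset.univ
      fun d : R => (d : A → ℂ) a • indicatorConstLp p (hB d) (hμB d) (1 : ℂ)] with ω h2 h3 h4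
    rw [h4, ← h3, Finset.sum_congr rfl fun d _ => h2 d]
    by_cases hω : t ω = 0
    · rw [Finset.sum_eq_zero fun d _ => ?_]
      · exact congrFun hω a
      · refine Set.indicator_of_notMem (fun h => d.2.2 ?_) _
        exact (Eq.symm h).trans hω
    · rw [Finset.sum_eq_single ⟨t ω, ⟨ω, rfl⟩, hω⟩ (fun d _ hd => ?_) (by simp)]
      · exact (Set.indicator_of_mem (s := {ω' | t ω' = t ω}) rfl fun _ => t ω a).symm
      · refine Set.indicator_of_notMem (fun h => hd (Subtype.ext ?_)) _
        exact Eq.symm h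

/-- A norm bound for a matrix of operators on `L^p(G)` persists after tensoring with the identity of
`L^p(Ω)`. On sums `∑ Ψ_d ⊗ 1_{B_d}` over disjoint sets the norm splits over `d`; these are dense. -/
theorem amplification_le (hp : p ≠ ∞) {n : ℕ} {a : Fin n → Fin n → Lp ℂ p ν →L[ℂ] Lp ℂ p ν}
    {A : Fin n → Fin n → Lp (Lp ℂ p μ) p ν →L[ℂ] Lp (Lp ℂ p μ) p ν}
    (hA : ∀ i j v ψ, A i j (tensorVec ν p v ψ) = tensorVec ν p v (a i j ψ)) {N : ℝ≥0∞} (hN : N ≠ ∞)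
    (ha : ∀ g : Fin n → Lp ℂ p ν,
      ∑ i, ‖∑ j, a i j (g j)‖ₑ ^ p.toReal ≤ N * ∑ j, ‖g j‖ₑ ^ p.toReal)
    (F : Fin n → Lp (Lp ℂ p μ) p ν) :
    ∑ i, ‖∑ j, A i j (F j)‖ₑ ^ p.toReal ≤ N * ∑ j, ‖F j‖ₑ ^ p.toReal := by
  let P : Set (Fin n → Lp (Lp ℂ p μ) p ν) :=
    {F | ∑ i, ‖∑ j, A i j (F j)‖ₑ ^ p.toReal ≤ N * ∑ j, ‖F j‖ₑ ^ p.toReal}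
  have hcont : ∀ L : (Fin n → Lp (Lp ℂ p μ) p ν) → Lp (Lp ℂ p μ) p ν, Continuous L →
      Continuous fun F => ‖L F‖ₑ ^ p.toReal := fun L hL =>
    ENNReal.continuous_rpow_const.comp hL.enorm
  have hP : IsClosed P := by
    refine isClosed_le (continuous_finsetSum _ fun i _ => hcont _ (continuous_finsetSum _
      fun j _ => (A i j).continuous.comp (continuous_apply j))) ?_
    exact (ENNReal.continuous_const_mul hN).comp
      (continuous_finsetSum _ fun j _ => hcont _ (continuous_apply j))
  -- The inequality for sums over disjoint sets.
  have h1 : ∀ (D : Type) [Fintype D] (B : D → Set Ω) (hB : ∀ d, MeasurableSet (B d))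
      (hμB : ∀ d, μ (B d) ≠ ∞), Pairwise (Function.onFun Disjoint B) →
      ∀ Ψ : Fin n → D → Lp ℂ p ν, (fun j => ∑ d, tensorVec ν p
        (indicatorConstLp p (hB d) (hμB d) (1 : ℂ)) (Ψ j d)) ∈ P := by
    intro D _ B hB hμB hdisj Ψ
    have h2 : ∀ i, ∑ j, A i j (∑ d, tensorVec ν p (indicatorConstLp p (hB d) (hμB d) (1 : ℂ))
        (Ψ j d)) = ∑ d, tensorVec ν p (indicatorConstLp p (hB d) (hμB d) (1 : ℂ))
          (∑ j, a i j (Ψ j d)) := fun i => by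
      simp only [_root_.map_sum, hA]
      exact Finset.sum_comm
    change ∑ i, ‖∑ j, A i j _‖ₑ ^ p.toReal ≤ N * ∑ j, ‖_‖ₑ ^ p.toReal
    simp only [h2, enorm_sum_tensorVec_indicatorConstLp_rpow hp hB hμB hdisj]
    rw [Finset.sum_comm, Finset.sum_comm (s := Finset.univ (α := Fin n)), Finset.mul_sum]
    refine Finset.sum_le_sum fun d _ => ?_
    rw [← Finset.sum_mul, ← Finset.sum_mul, ← mul_assoc]
    gcongr
    exact ha fun j => Ψ j d
  -- The inequality for finite sums of elementary tensors, by approximating the vectors in `L^p(Ω)`.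
  have h3 : ∀ (m : Fin n → ℕ) (ψ : ∀ j, Fin (m j) → Lp ℂ p ν) (v : (Σ j, Fin (m j)) → Lp ℂ p μ),
      (fun j => ∑ l, tensorVec ν p (v ⟨j, l⟩) (ψ j l)) ∈ P := by
    intro m ψ
    have hcl : IsClosed {v : (Σ j, Fin (m j)) → Lp ℂ p μ |
        (fun j => ∑ l, tensorVec ν p (v ⟨j, l⟩) (ψ j l)) ∈ P} := by
      refine hP.preimage (continuous_pi fun j => continuous_finsetSum _ fun l _ => ?_)
      exact (tensorFun (ψ j l)).continuous.comp (continuous_apply _)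
    have hd : Dense (Set.pi Set.univ fun _ : Σ j, Fin (m j) =>
        ((Lp.simpleFunc ℂ p μ : AddSubgroup (Lp ℂ p μ)) : Set (Lp ℂ p μ))) :=
      dense_pi _ fun _ _ => Lp.simpleFunc.dense hp
    intro v
    refine hcl.closure_subset_iff.2 ?_ (hd v)
    intro v hv
    obtain ⟨D, _, B, hB, hμB, c, hdisj, hvc⟩ :=
      exists_common_indicatorConstLp hp fun a => hv a (Set.mem_univ _)
    have h4 : (fun j => ∑ l, tensorVec ν p (v ⟨j, l⟩) (ψ j l)) = fun j => ∑ d, tensorVec ν p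
        (indicatorConstLp p (hB d) (hμB d) (1 : ℂ)) (∑ l, c ⟨j, l⟩ d • ψ j l) := by
      funext j
      simp only [_root_.map_sum, ← tensorVec_smul]
      rw [Finset.sum_comm]
      refine Finset.sum_congr rfl fun l _ => ?_
      rw [← tensorFun_apply, hvc, _root_.map_sum]
      rfl
    change (fun j => ∑ l, tensorVec ν p (v ⟨j, l⟩) (ψ j l)) ∈ P
    rw [h4]
    exact h1 D B hB hμB hdisj _
  have h5 : ∀ F : Fin n → Lp (Lp ℂ p μ) p ν, (∀ j, F j ∈ (Submodule.span ℂ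
      {F | ∃ ψ v, F = tensorVec ν p v ψ} : Submodule ℂ (Lp (Lp ℂ p μ) p ν))) → F ∈ P := by
    intro F hF
    have h6 : ∀ j, ∃ (m : ℕ) (ψ : Fin m → Lp ℂ p ν) (v : Fin m → Lp ℂ p μ),
        F j = ∑ l, tensorVec ν p (v l) (ψ l) := fun j => by
      obtain ⟨m, c, g, hg⟩ := Submodule.mem_span_set'.1 (hF j)
      choose ψ v hψ using fun l => (g l).2
      refine ⟨m, fun l => c l • ψ l, v, ?_⟩
      rw [← hg]
      refine Finset.sum_congr rfl fun l _ => ?_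
      rw [hψ, map_smul]
    choose m ψ v hψ using h6
    have : F = fun j => ∑ l, tensorVec ν p (v j l) (ψ j l) := funext hψ
    rw [this]
    exact h3 m ψ fun z => v z.1 z.2
  have hd : Dense (Set.pi Set.univ fun _ : Fin n => ((Submodule.span ℂ
      {F | ∃ ψ v, F = tensorVec ν p v ψ} : Submodule ℂ (Lp (Lp ℂ p μ) p ν)) :
        Set (Lp (Lp ℂ p μ) p ν))) :=
    dense_pi _ fun _ _ F => mem_closure_span_tensorVec hp F
  refine hP.closure_subset_iff.2 ?_ (hd F)
  intro F hF
  exact h5 F fun j => hF j (Set.mem_univ _)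

end Amplification

/-! ### Transference -/

section Reiter

variable {G : Type*} [TopologicalSpace G] [Group G] [IsTopologicalGroup G]
    [LocallyCompactSpace G] [T2Space G] [MeasurableSpace G] [BorelSpace G]
    {ν : Measure G} [IsHaarMeasure ν] [Regular ν] {p : ℝ≥0∞} [Fact (1 ≤ p)]

theorem integrable_norm_mul_norm_leftRegular_sub (hp : p ≠ ∞) {k : G → ℂ} (hk : Integrable k ν)
    (ψ : Lp ℂ p ν) : Integrable (fun y => ‖k y‖ * ‖leftRegular ν ℂ ℂ p y ψ - ψ‖) ν := by
  have h : AEStronglyMeasurable (fun y => k y • (leftRegular ν ℂ ℂ p y ψ - ψ)) ν :=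
    (memLp_one_iff_integrable.2 hk).aestronglyMeasurable_smul_of_continuous le_rfl (by simp)
      ((continuous_leftRegular hp ψ).sub continuous_const)
  refine (hk.norm.mul_const (‖ψ‖ + ‖ψ‖)).mono' (h.norm.congr (ae_of_all _ fun y => norm_smul _ _))
    (ae_of_all _ fun y => ?_)
  rw [Real.norm_of_nonneg (by positivity)]
  gcongr
  exact (norm_sub_le _ _).trans_eq (by rw [norm_leftRegular_apply])

/-- Reiter's condition, averaged against finitely many integrable functions instead of uniform on
a compact set. -/
theorem exists_integral_norm_leftRegular_sub_le (hG : IsAmenableGroup G) (hp : p ≠ ∞) {ι : Type*}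
    [Fintype ι] {k : ι → G → ℂ} (hk : ∀ i, Integrable (k i) ν) {ε : ℝ} (hε : 0 < ε) :
    ∃ ψ : Lp ℂ p ν, ‖ψ‖ = 1 ∧
      ∀ i, ∫ y, ‖k i y‖ * ‖leftRegular ν ℂ ℂ p y ψ - ψ‖ ∂ν ≤ ε := by
  have h1 : ∀ i, ∃ g : G → ℂ, HasCompactSupport g ∧ Integrable g ν ∧
      ∫ y, ‖k i y - g y‖ ∂ν ≤ ε / 4 := fun i => by
    obtain ⟨g, hg, hkg, -, hgm⟩ := (memLp_one_iff_integrable.2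
      (hk i)).exists_hasCompactSupport_eLpNorm_sub_le_of_regularSpace (by simp)
      (ENNReal.ofReal_pos.2 (by positivity : 0 < ε / 4)).ne'
    have hgi := memLp_one_iff_integrable.1 hgm
    refine ⟨g, hg, hgi, ?_⟩
    rw [eLpNorm_one_eq_lintegral_enorm, ← ofReal_integral_norm_eq_lintegral_enorm
      ((hk i).sub hgi)] at hkg
    exact (ENNReal.ofReal_le_ofReal_iff (by positivity)).1 hkg
  choose g hg hgi hkg using h1
  have hS : ∀ i, ∫ y, ‖g i y‖ ∂ν ≤ ∑ i, ∫ y, ‖g i y‖ ∂ν := fun i =>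
    Finset.single_le_sum (f := fun i => ∫ y, ‖g i y‖ ∂ν)
      (fun _ _ => integral_nonneg fun _ => norm_nonneg _) (Finset.mem_univ i)
  set S := ∑ i, ∫ y, ‖g i y‖ ∂ν
  have hS0 : 0 ≤ S := Finset.sum_nonneg fun _ _ => integral_nonneg fun _ => norm_nonneg _
  obtain ⟨ψ, hψ, hψK⟩ := exists_reiter_Lp ν hG hp
    (isCompact_iUnion fun i => (hg i).isCompact) (by positivity : 0 < ε / (2 * (S + 1)))
  refine ⟨ψ, hψ, fun i => ?_⟩
  have h2 : ∀ y, ‖k i y‖ * ‖leftRegular ν ℂ ℂ p y ψ - ψ‖ ≤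
      ‖k i y - g i y‖ * 2 + ‖g i y‖ * (ε / (2 * (S + 1))) := fun y => by
    have h3 : ‖leftRegular ν ℂ ℂ p y ψ - ψ‖ ≤ 2 :=
      (norm_sub_le _ _).trans_eq (by rw [norm_leftRegular_apply, hψ]; norm_num)
    have h4 : ‖g i y‖ * ‖leftRegular ν ℂ ℂ p y ψ - ψ‖ ≤ ‖g i y‖ * (ε / (2 * (S + 1))) := by
      by_cases hy : g i y = 0
      · simp [hy]
      · gcongr
        exact hψK y (Set.mem_iUnion.2 ⟨i, subset_tsupport _ hy⟩)
    calc ‖k i y‖ * ‖leftRegular ν ℂ ℂ p y ψ - ψ‖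
        ≤ (‖k i y - g i y‖ + ‖g i y‖) * ‖leftRegular ν ℂ ℂ p y ψ - ψ‖ := by
          gcongr
          exact norm_le_norm_sub_add _ _
      _ ≤ _ := by
          rw [add_mul]
          gcongr
  have hd : Integrable (fun y => ‖k i y - g i y‖) ν := ((hk i).sub (hgi i)).norm
  calc ∫ y, ‖k i y‖ * ‖leftRegular ν ℂ ℂ p y ψ - ψ‖ ∂ν
      ≤ ∫ y, (‖k i y - g i y‖ * 2 + ‖g i y‖ * (ε / (2 * (S + 1)))) ∂ν :=
        integral_mono (integrable_norm_mul_norm_leftRegular_sub hp (hk i) ψ)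
          ((hd.mul_const _).add ((hgi i).norm.mul_const _)) h2
    _ = (∫ y, ‖k i y - g i y‖ ∂ν) * 2 + (∫ y, ‖g i y‖ ∂ν) * (ε / (2 * (S + 1))) := by
        rw [integral_add (hd.mul_const _) ((hgi i).norm.mul_const _), integral_mul_const,
          integral_mul_const]
    _ ≤ ε / 4 * 2 + (S + 1) * (ε / (2 * (S + 1))) := by
        gcongr
        · exact hkg i
        · exact (hS i).trans (by linarith)
    _ = ε := by
        field_simp
        ring

end Reiter

section Transference

variable {G : Type*} [TopologicalSpace G] [Group G] [IsTopologicalGroup G]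
    [LocallyCompactSpace G] [T2Space G] [MeasurableSpace G] [BorelSpace G]
    {ν : Measure G} [IsHaarMeasure ν] [Regular ν] {p : ℝ≥0∞} [Fact (1 ≤ p)]
    {E : Type*} [NormedAddCommGroup E] [NormedSpace ℂ E] {π : G →* (E →L[ℂ] E)} {B : ℝ}

theorem memLp_smul_rep_inv (hp : p ≠ ∞) (hc : ∀ f, Continuous fun x => π x f)
    (hB : ∀ x, ‖π x‖ ≤ B) (ψ : Lp ℂ p ν) (f : E) : MemLp (fun x => ψ x • π x⁻¹ f) p ν := by
  have h1 : Continuous fun x => π x⁻¹ f := (hc f).comp continuous_inv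
  refine ((Lp.memLp ψ).norm.mul_const (B * ‖f‖)).mono'
    ((Lp.memLp ψ).aestronglyMeasurable_smul_of_continuous Fact.out hp h1)
    (ae_of_all _ fun x => ?_)
  rw [norm_smul]
  gcongr
  exact (π x⁻¹).le_of_opNorm_le (hB _) f

/-- The function `x ↦ ψ(x) π(x⁻¹) f` in `L^p(G; E)`. As a map of `f` it is a two-sided bounded
embedding of `E`, and for nearly invariant `ψ` it nearly intertwines `π` with the left regular
representation. -/
noncomputable def orbitMap (hp : p ≠ ∞) (hc : ∀ f, Continuous fun x => π x f)
    (hB : ∀ x, ‖π x‖ ≤ B) (ψ : Lp ℂ p ν) : E →L[ℂ] Lp E p ν :=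
  LinearMap.mkContinuous
    { toFun := fun f => (memLp_smul_rep_inv hp hc hB ψ f).toLp
      map_add' := fun f g => by
        rw [← MemLp.toLp_add]
        congr 1
        ext x
        simp
      map_smul' := fun c f => by
        rw [RingHom.id_apply, ← MemLp.toLp_const_smul]
        congr 1
        ext x
        simp only [map_smul, Pi.smul_apply]
        exact smul_comm _ _ _ } (B * ‖ψ‖) fun f => by
    rw [mul_assoc, mul_comm ‖ψ‖, ← mul_assoc]
    refine Lp.norm_le_mul_norm_of_ae_le_mul ?_
    filter_upwards [(memLp_smul_rep_inv hp hc hB ψ f).coeFn_toLp] with x hx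
    refine (congrArg norm hx).trans_le ?_
    rw [norm_smul, mul_comm]
    gcongr
    exact (π x⁻¹).le_of_opNorm_le (hB _) f

variable {hp : p ≠ ∞} {hc : ∀ f, Continuous fun x => π x f} {hB : ∀ x, ‖π x‖ ≤ B}

theorem orbitMap_coeFn (ψ : Lp ℂ p ν) (f : E) :
    orbitMap hp hc hB ψ f =ᵐ[ν] fun x => ψ x • π x⁻¹ f :=
  (memLp_smul_rep_inv hp hc hB ψ f).coeFn_toLp

theorem norm_orbitMap_apply_le (ψ : Lp ℂ p ν) (f : E) :
    ‖orbitMap hp hc hB ψ f‖ ≤ B * ‖ψ‖ * ‖f‖ := by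
  have hB0 : 0 ≤ B := (norm_nonneg _).trans (hB 1)
  exact ContinuousLinearMap.le_of_opNorm_le _
    (LinearMap.mkContinuous_norm_le _ (by positivity) _) f

/-- The lower bound for `orbitMap`, from `‖f‖ ≤ B ‖π(x⁻¹) f‖` at every point `x`. -/
theorem norm_mul_norm_le_norm_orbitMap_apply (ψ : Lp ℂ p ν) (f : E) :
    ‖f‖ * ‖ψ‖ ≤ B * ‖orbitMap hp hc hB ψ f‖ := by
  have h : ‖(‖f‖ : ℂ) • ψ‖ ≤ B * ‖orbitMap hp hc hB ψ f‖ := by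
    refine Lp.norm_le_mul_norm_of_ae_le_mul ?_
    filter_upwards [orbitMap_coeFn (hp := hp) (hc := hc) (hB := hB) ψ f,
      Lp.coeFn_smul (‖f‖ : ℂ) ψ] with x h1 h2
    have h3 : π x (π x⁻¹ f) = f := by
      rw [← mul_apply_eq_comp, ← map_mul, mul_inv_cancel, map_one,
        one_apply_eq_self]
    have h4 : ‖f‖ ≤ B * ‖π x⁻¹ f‖ := by
      conv_lhs => rw [← h3]
      exact (π x).le_of_opNorm_le (hB x) _
    rw [h1, h2, Pi.smul_apply, norm_smul, norm_smul]
    simp only [Complex.norm_real, norm_norm]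
    calc ‖f‖ * ‖ψ x‖ ≤ (B * ‖π x⁻¹ f‖) * ‖ψ x‖ := by gcongr
      _ = _ := by ring
  rwa [norm_smul, Complex.norm_real, norm_norm] at h

theorem orbitMap_sub_apply (ψ φ : Lp ℂ p ν) (f : E) :
    orbitMap hp hc hB (ψ - φ) f = orbitMap hp hc hB ψ f - orbitMap hp hc hB φ f := by
  apply Lp.ext
  filter_upwards [orbitMap_coeFn (hp := hp) (hc := hc) (hB := hB) ψ f,
    orbitMap_coeFn (hp := hp) (hc := hc) (hB := hB) φ f,
    orbitMap_coeFn (hp := hp) (hc := hc) (hB := hB) (ψ - φ) f, Lp.coeFn_sub ψ φ,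
    Lp.coeFn_sub (orbitMap hp hc hB ψ f) (orbitMap hp hc hB φ f)] with x h1 h2 h3 h4 h5
  rw [h3, h5, Pi.sub_apply, h1, h2, h4, Pi.sub_apply, sub_smul]

theorem leftRegular_orbitMap (y : G) (ψ : Lp ℂ p ν) (f : E) :
    leftRegular ν ℂ E p y (orbitMap hp hc hB ψ f) =
      orbitMap hp hc hB (leftRegular ν ℂ ℂ p y ψ) (π y f) := by
  apply Lp.ext
  filter_upwards [leftRegular_toLp_coeFn (𝕜 := ℂ) y (memLp_smul_rep_inv hp hc hB ψ f),
    leftRegular_coeFn (𝕜 := ℂ) y ψ, orbitMap_coeFn (hp := hp) (hc := hc) (hB := hB)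
      (leftRegular ν ℂ ℂ p y ψ) (π y f)] with x h1 h2 h3
  refine Eq.trans h1 ?_
  rw [h3, h2, ← mul_apply_eq_comp, ← map_mul]
  simp

/-- Since `λ(y)` maps the orbit of `(ψ, f)` to that of `(λ(y) ψ, π(y) f)`, convolution by `k` on
`L^p(G; E)` differs from the integrated form of `π` only by the displacement of `ψ`, averaged against
`k`. -/
theorem norm_integratedForm_orbitMap_sub_le [CompleteSpace E] {k : G → ℂ} (hk : Integrable k ν)
    (ψ : Lp ℂ p ν) (f : E) :
    ‖integratedForm ν (leftRegular ν ℂ E p) (continuous_leftRegular hp) bounded_leftRegular k hk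
        (orbitMap hp hc hB ψ f) -
      orbitMap hp hc hB ψ (integratedForm ν π hc ⟨B, hB⟩ k hk f)‖ ≤
      (∫ y, ‖k y‖ * ‖leftRegular ν ℂ ℂ p y ψ - ψ‖ ∂ν) * (B ^ 2 * ‖f‖) := by
  have hB0 : 0 ≤ B := (norm_nonneg _).trans (hB 1)
  have hi := integrable_smul_rep hk hc ⟨B, hB⟩ f
  have hi' : Integrable (fun y => k y • leftRegular ν ℂ E p y (orbitMap hp hc hB ψ f)) ν :=
    integrable_smul_rep hk (π := leftRegular ν ℂ E p) (continuous_leftRegular hp)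
      bounded_leftRegular (orbitMap hp hc hB ψ f)
  have h1 : orbitMap hp hc hB ψ (integratedForm ν π hc ⟨B, hB⟩ k hk f) =
      ∫ y, orbitMap hp hc hB ψ (k y • π y f) ∂ν :=
    ((orbitMap hp hc hB ψ).integral_comp_comm hi).symm
  rw [integratedForm_apply, h1, ← integral_sub hi' ((orbitMap hp hc hB ψ).integrable_comp hi),
    ← integral_mul_const]
  refine norm_integral_le_of_norm_le
    ((integrable_norm_mul_norm_leftRegular_sub hp hk ψ).mul_const _) (ae_of_all _ fun y => ?_)
  rw [leftRegular_orbitMap, map_smul, ← smul_sub, ← orbitMap_sub_apply, norm_smul, mul_assoc]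
  gcongr
  calc ‖orbitMap hp hc hB (leftRegular ν ℂ ℂ p y ψ - ψ) (π y f)‖
      ≤ B * ‖leftRegular ν ℂ ℂ p y ψ - ψ‖ * (B * ‖f‖) := by
        refine (norm_orbitMap_apply_le _ _).trans ?_
        gcongr
        exact (π y).le_of_opNorm_le (hB y) f
    _ = _ := by ring

theorem leftRegular_tensorVec (y : G) (v : E) (ψ : Lp ℂ p ν) :
    leftRegular ν ℂ E p y (tensorVec ν p v ψ) = tensorVec ν p v (leftRegular ν ℂ ℂ p y ψ) := by
  apply Lp.ext
  filter_upwards [leftRegular_coeFn (𝕜 := ℂ) y (tensorVec ν p v ψ),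
    (measurePreserving_mul_left ν y⁻¹).quasiMeasurePreserving.ae_eq_comp (tensorVec_coeFn v ψ),
    leftRegular_coeFn (𝕜 := ℂ) y ψ, tensorVec_coeFn v (leftRegular ν ℂ ℂ p y ψ)]
    with x h1 h2 h3 h4
  rw [h1, h4, h3]
  exact h2

end Transference

section MatrixTransference

variable {G : Type*} [TopologicalSpace G] [Group G] [IsTopologicalGroup G]
    [LocallyCompactSpace G] [T2Space G] [MeasurableSpace G] [BorelSpace G]
    {ν : Measure G} [IsHaarMeasure ν] [Regular ν] {p : ℝ≥0∞} [Fact (1 ≤ p)]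
    {Ω : Type*} [MeasurableSpace Ω] {μ : Measure Ω}
    {π : G →* (Lp ℂ p μ →L[ℂ] Lp ℂ p μ)} {B : ℝ}

theorem ofReal_sum_norm_rpow {F : Type*} [NormedAddCommGroup F] {n : ℕ} (p : ℝ≥0∞)
    (g : Fin n → F) :
    ENNReal.ofReal (∑ i, ‖g i‖ ^ p.toReal) = ∑ i, ‖g i‖ₑ ^ p.toReal := by
  rw [ENNReal.ofReal_sum_of_nonneg fun _ _ => by positivity]
  refine Finset.sum_congr rfl fun i _ => ?_
  rw [← ofReal_norm, ENNReal.ofReal_rpow_of_nonneg (norm_nonneg _) (by positivity)]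

/-- The transference principle for matrices of convolution operators. The two factors `B ^ p` come
from the upper and the lower bound of `orbitMap`. -/
theorem sum_norm_integratedForm_rpow_le (hG : IsAmenableGroup G) (hp : p ≠ ∞)
    (hc : ∀ f, Continuous fun x => π x f) (hB : ∀ x, ‖π x‖ ≤ B) {n : ℕ}
    {k : Fin n → Fin n → G → ℂ} (hk : ∀ i j, Integrable (k i j) ν) {N : ℝ} (hN : 0 ≤ N)
    (h : ∀ g : Fin n → Lp ℂ p ν, ∑ i, ‖∑ j, integratedForm ν (leftRegular ν ℂ ℂ p)
      (continuous_leftRegular hp) bounded_leftRegular (k i j) (hk i j) (g j)‖ ^ p.toReal ≤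
        N * ∑ j, ‖g j‖ ^ p.toReal) (f : Fin n → Lp ℂ p μ) :
    ∑ i, ‖∑ j, integratedForm ν π hc ⟨B, hB⟩ (k i j) (hk i j) (f j)‖ ^ p.toReal ≤
      (B ^ p.toReal) ^ 2 * N * ∑ j, ‖f j‖ ^ p.toReal := by
  have hp0 : p ≠ 0 := (one_pos.trans_le (Fact.out : 1 ≤ p)).ne'
  have hpr : 0 < p.toReal := ENNReal.toReal_pos hp0 hp
  have hB0 : 0 ≤ B := (norm_nonneg _).trans (hB 1)
  let A : Fin n → Fin n → Lp (Lp ℂ p μ) p ν →L[ℂ] Lp (Lp ℂ p μ) p ν := fun i j =>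
    integratedForm ν (leftRegular ν ℂ (Lp ℂ p μ) p) (continuous_leftRegular hp)
      bounded_leftRegular (k i j) (hk i j)
  have hA : ∀ F : Fin n → Lp (Lp ℂ p μ) p ν,
      ∑ i, ‖∑ j, A i j (F j)‖ ^ p.toReal ≤ N * ∑ j, ‖F j‖ ^ p.toReal := fun F => by
    refine (ENNReal.ofReal_le_ofReal_iff (by positivity)).1 ?_
    rw [ENNReal.ofReal_mul hN, ofReal_sum_norm_rpow, ofReal_sum_norm_rpow]
    refine amplification_le hp (a := fun i j => integratedForm ν (leftRegular ν ℂ ℂ p)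
      (continuous_leftRegular hp) bounded_leftRegular (k i j) (hk i j)) (fun i j v ψ => ?_) ENNReal.ofReal_ne_top (fun g => ?_) F
    · exact (map_integratedForm (tensorVec ν p v)
        (fun x φ => (leftRegular_tensorVec x v φ).symm) ψ).symm
    · rw [← ofReal_sum_norm_rpow, ← ofReal_sum_norm_rpow, ← ENNReal.ofReal_mul hN]
      exact ENNReal.ofReal_le_ofReal (h g)
  let a : Fin n → ℝ := fun i => ‖∑ j, integratedForm ν π hc ⟨B, hB⟩ (k i j) (hk i j) (f j)‖
  let C : ℝ := B * ∑ j, B ^ 2 * ‖f j‖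
  -- The estimate up to an error `ε`, which is then sent to zero.
  have h1 : ∀ ε : ℝ, 0 < ε → ∑ i, max 0 (a i - ε * C) ^ p.toReal ≤
      (B ^ p.toReal) ^ 2 * N * ∑ j, ‖f j‖ ^ p.toReal := by
    intro ε hε
    obtain ⟨ψ, hψ, hψk⟩ := exists_integral_norm_leftRegular_sub_le (p := p) hG hp
      (k := fun z : Fin n × Fin n => k z.1 z.2) (fun z => hk z.1 z.2) hε
    have h2 : ∀ i, max 0 (a i - ε * C) ≤ B * ‖∑ j, A i j (orbitMap hp hc hB ψ (f j))‖ := by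
      intro i
      refine max_le (by positivity) (sub_le_iff_le_add.2 ?_)
      have h3 := norm_mul_norm_le_norm_orbitMap_apply (hp := hp) (hc := hc) (hB := hB) ψ
        (∑ j, integratedForm ν π hc ⟨B, hB⟩ (k i j) (hk i j) (f j))
      rw [hψ, mul_one] at h3
      refine h3.trans ?_
      have h4 : ‖∑ j, A i j (orbitMap hp hc hB ψ (f j)) - orbitMap hp hc hB ψ
          (∑ j, integratedForm ν π hc ⟨B, hB⟩ (k i j) (hk i j) (f j))‖ ≤
            ε * ∑ j, B ^ 2 * ‖f j‖ := by
        rw [_root_.map_sum, ← Finset.sum_sub_distrib, Finset.mul_sum]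
        refine norm_sum_le_of_le _ fun j _ => ?_
        refine (norm_integratedForm_orbitMap_sub_le (hk i j) ψ (f j)).trans ?_
        gcongr
        exact hψk (i, j)
      calc _ ≤ B * (‖∑ j, A i j (orbitMap hp hc hB ψ (f j))‖ + ε * ∑ j, B ^ 2 * ‖f j‖) := by
            gcongr
            exact (norm_le_norm_add_norm_sub _ _).trans (by gcongr)
        _ = _ := by
            simp only [C]
            ring
    calc ∑ i, max 0 (a i - ε * C) ^ p.toReal
        ≤ ∑ i, (B * ‖∑ j, A i j (orbitMap hp hc hB ψ (f j))‖) ^ p.toReal := by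
          gcongr with i
          exact h2 i
      _ = B ^ p.toReal * ∑ i, ‖∑ j, A i j (orbitMap hp hc hB ψ (f j))‖ ^ p.toReal := by
          rw [Finset.mul_sum]
          exact Finset.sum_congr rfl fun i _ => Real.mul_rpow hB0 (norm_nonneg _)
      _ ≤ B ^ p.toReal * (N * ∑ j, ‖orbitMap hp hc hB ψ (f j)‖ ^ p.toReal) := by
          gcongr
          exact hA _
      _ ≤ B ^ p.toReal * (N * ∑ j, (B * ‖f j‖) ^ p.toReal) := by
          gcongr with j
          refine (norm_orbitMap_apply_le _ _).trans_eq ?_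
          rw [hψ, mul_one]
      _ = _ := by
          simp only [Real.mul_rpow hB0 (norm_nonneg _), ← Finset.mul_sum]
          ring
  have h5 : Tendsto (fun ε : ℝ => ∑ i, max 0 (a i - ε * C) ^ p.toReal) (𝓝[>] 0)
      (𝓝 (∑ i, max 0 (a i - 0 * C) ^ p.toReal)) := by
    refine ((continuous_finsetSum _ fun i _ => ?_).tendsto 0).mono_left nhdsWithin_le_nhds
    exact (continuous_const.max (continuous_const.sub
      (continuous_id.mul continuous_const))).rpow_const fun _ => Or.inr hpr.le
  have h6 := le_of_tendsto h5 (eventually_nhdsWithin_of_forall h1)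
  refine le_trans (le_of_eq ?_) h6
  refine Finset.sum_congr rfl fun i _ => ?_
  rw [zero_mul, sub_zero, max_eq_right (norm_nonneg _)]

end MatrixTransference

/-! ### Matrix norms -/

section MatrixNorm

variable {p : ℝ≥0∞} [Fact (1 ≤ p)] {E : Type*} [NormedAddCommGroup E] [NormedSpace ℂ E] {n : ℕ}

theorem matrixNorm_nonneg (m : Matrix (Fin n) (Fin n) (E →L[ℂ] E)) : 0 ≤ matrixNorm p m :=
  Real.sSup_nonneg (by rintro _ ⟨g, -, rfl⟩; positivity)

theorem matrixNorm_le (hp : p ≠ ∞) {m : Matrix (Fin n) (Fin n) (E →L[ℂ] E)} {C : ℝ} (hC : 0 ≤ C)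
    (h : ∀ g : Fin n → E,
      ∑ i, ‖∑ j, m i j (g j)‖ ^ p.toReal ≤ C ^ p.toReal * ∑ j, ‖g j‖ ^ p.toReal) :
    matrixNorm p m ≤ C := by
  have hpr : 0 < p.toReal :=
    ENNReal.toReal_pos (one_pos.trans_le (Fact.out : 1 ≤ p)).ne' hp
  refine Real.sSup_le ?_ hC
  rintro _ ⟨g, hg, rfl⟩
  have h1 : ∑ j, ‖g j‖ ^ p.toReal ≤ 1 := by
    rwa [one_div, Real.rpow_inv_le_iff_of_pos (by positivity) zero_le_one hpr,
      Real.one_rpow] at hg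
  rw [one_div, Real.rpow_inv_le_iff_of_pos (by positivity) hC hpr]
  exact (h g).trans (mul_le_of_le_one_right (by positivity) h1)

theorem bddAbove_matrixNorm (hp : p ≠ ∞) (m : Matrix (Fin n) (Fin n) (E →L[ℂ] E)) :
    BddAbove {r : ℝ | ∃ g : Fin n → E, (∑ j, ‖g j‖ ^ p.toReal) ^ (1 / p.toReal) ≤ 1 ∧
      r = (∑ i, ‖∑ j, m i j (g j)‖ ^ p.toReal) ^ (1 / p.toReal)} := by
  have hpr : 0 < p.toReal :=
    ENNReal.toReal_pos (one_pos.trans_le (Fact.out : 1 ≤ p)).ne' hp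
  refine ⟨(∑ i, (∑ j, ‖m i j‖) ^ p.toReal) ^ (1 / p.toReal), ?_⟩
  rintro _ ⟨g, hg, rfl⟩
  have h1 : ∀ j, ‖g j‖ ≤ 1 := fun j => by
    rw [one_div, Real.rpow_inv_le_iff_of_pos (by positivity) zero_le_one hpr,
      Real.one_rpow] at hg
    have h2 : ‖g j‖ ^ p.toReal ≤ 1 ^ p.toReal := by
      rw [Real.one_rpow]
      exact (Finset.single_le_sum (f := fun j => ‖g j‖ ^ p.toReal) (fun _ _ => by positivity)
        (Finset.mem_univ j)).trans hg
    exact (Real.rpow_le_rpow_iff (norm_nonneg _) zero_le_one hpr).1 h2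
  gcongr with i
  exact norm_sum_le_of_le _ fun j _ => (m i j).le_of_opNorm_le_of_le le_rfl (h1 j) |>.trans_eq
    (mul_one _)

/-- The supremum that defines `matrixNorm` is a genuine one, so by homogeneity it bounds the action
of the matrix on arbitrary vectors. -/
theorem sum_norm_rpow_le_matrixNorm (hp : p ≠ ∞) (m : Matrix (Fin n) (Fin n) (E →L[ℂ] E))
    (g : Fin n → E) :
    ∑ i, ‖∑ j, m i j (g j)‖ ^ p.toReal ≤ matrixNorm p m ^ p.toReal * ∑ j, ‖g j‖ ^ p.toReal := by
  have hpr : 0 < p.toReal :=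
    ENNReal.toReal_pos (one_pos.trans_le (Fact.out : 1 ≤ p)).ne' hp
  set s := ∑ j, ‖g j‖ ^ p.toReal with hs
  have hs0 : 0 ≤ s := by positivity
  rcases hs0.eq_or_lt with h0 | hpos
  · have h1 : ∀ j, g j = 0 := fun j => by
      have h2 := (Finset.sum_eq_zero_iff_of_nonneg fun _ _ => by positivity).1 h0.symm j
        (Finset.mem_univ j)
      exact norm_eq_zero.1 ((Real.rpow_eq_zero (norm_nonneg _) hpr.ne').1 h2)
    simp [h1, ← h0, hpr.ne']
  · set r := s ^ p.toReal⁻¹ with hr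
    have hr0 : 0 < r := Real.rpow_pos_of_pos hpos _
    have hrs : r ^ p.toReal = s := Real.rpow_inv_rpow hs0 hpr.ne'
    have hnorm : ∀ x : E, ‖((r⁻¹ : ℝ) : ℂ) • x‖ ^ p.toReal = s⁻¹ * ‖x‖ ^ p.toReal := fun x => by
      rw [norm_smul, Complex.norm_real, Real.norm_of_nonneg (by positivity),
        Real.mul_rpow (by positivity) (norm_nonneg _), Real.inv_rpow hr0.le, hrs]
    have h1 : (∑ i, ‖∑ j, m i j (((r⁻¹ : ℝ) : ℂ) • g j)‖ ^ p.toReal) ^ (1 / p.toReal) ≤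
        matrixNorm p m := by
      refine le_csSup (bddAbove_matrixNorm hp m) ⟨fun j => ((r⁻¹ : ℝ) : ℂ) • g j, ?_, rfl⟩
      simp only [hnorm, ← Finset.mul_sum]
      rw [← hs, inv_mul_cancel₀ hpos.ne', Real.one_rpow]
    rw [one_div, Real.rpow_inv_le_iff_of_pos (by positivity) (matrixNorm_nonneg m) hpr] at h1
    simp only [map_smul, ← Finset.smul_sum, hnorm, ← Finset.mul_sum] at h1
    rwa [inv_mul_le_iff₀ hpos, mul_comm] at h1

end MatrixNorm

/-! ### The homomorphism on convolution operators -/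

section Homomorphism

variable {G : Type*} [TopologicalSpace G] [Group G] [IsTopologicalGroup G]
    [LocallyCompactSpace G] [T2Space G] [MeasurableSpace G] [BorelSpace G]
    {ν : Measure G} [IsHaarMeasure ν] [Regular ν]

/-- The integrated form is multiplicative for the convolution product of `L¹(G)`, which is encoded
as the integrated form of the left regular representation on `L¹(G)`. -/
theorem integratedForm_convolution {E : Type*} [NormedAddCommGroup E] [NormedSpace ℂ E]
    [NormedSpace ℝ E] [SMulCommClass ℝ ℂ E] [CompleteSpace E] {π : G →* (E →L[ℂ] E)} {hc : ∀ f, Continuous fun x => π x f}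
    {hb : ∃ B : ℝ, ∀ x, ‖π x‖ ≤ B} {k l : G → ℂ} (hk : Integrable k ν) (hl : Integrable l ν)
    (f : E) :
    integratedForm ν π hc hb (integratedForm ν (leftRegular ν ℂ ℂ 1)
        (continuous_leftRegular ENNReal.one_ne_top) bounded_leftRegular k hk
        ((memLp_one_iff_integrable.2 hl).toLp l)) (L1.integrable_coeFn _) f =
      integratedForm ν π hc hb k hk (integratedForm ν π hc hb l hl f) := by
  have h := map_integratedForm (hc := continuous_leftRegular ENNReal.one_ne_top)
    (hb := bounded_leftRegular) (hc' := hc) (hb' := hb) (hk := hk) (integratedFormL1 ν π hc hb f)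
    (integratedFormL1_leftRegular f) ((memLp_one_iff_integrable.2 hl).toLp l)
  rw [integratedFormL1_toLp] at h
  exact h

variable {p : ℝ≥0∞} [Fact (1 ≤ p)]

theorem IsConvolutionOperator.eq_integratedForm (hp : p ≠ ∞) {k : G → ℂ}
    {T : Lp ℂ p ν →L[ℂ] Lp ℂ p ν} (hT : IsConvolutionOperator ν p k T) (hk : Integrable k ν) :
    T = integratedForm ν (leftRegular ν ℂ ℂ p) (continuous_leftRegular hp)
      bounded_leftRegular k hk :=
  hT.unique (isConvolutionOperator_integratedForm hp hk)

theorem IsConvolutionOperator.add (hp : p ≠ ∞) {k l : G → ℂ} (hk : Integrable k ν)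
    (hl : Integrable l ν) {S T : Lp ℂ p ν →L[ℂ] Lp ℂ p ν} (hS : IsConvolutionOperator ν p k S)
    (hT : IsConvolutionOperator ν p l T) : IsConvolutionOperator ν p (k + l) (S + T) := by
  rw [hS.eq_integratedForm hp hk, hT.eq_integratedForm hp hl,
    ← integratedForm_add (hkl := hk.add hl)]
  exact isConvolutionOperator_integratedForm hp _

theorem IsConvolutionOperator.const_smul (hp : p ≠ ∞) (c : ℂ) {k : G → ℂ} (hk : Integrable k ν)
    {T : Lp ℂ p ν →L[ℂ] Lp ℂ p ν} (hT : IsConvolutionOperator ν p k T) :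
    IsConvolutionOperator ν p (c • k) (c • T) := by
  rw [hT.eq_integratedForm hp hk, ← integratedForm_smul (hck := hk.smul c)]
  exact isConvolutionOperator_integratedForm hp _

/-- A product of convolution operators is convolution by the product of the kernels in `L¹(G)`. -/
theorem IsConvolutionOperator.mul (hp : p ≠ ∞) {k l : G → ℂ} (hk : Integrable k ν)
    (hl : Integrable l ν) {S T : Lp ℂ p ν →L[ℂ] Lp ℂ p ν} (hS : IsConvolutionOperator ν p k S)
    (hT : IsConvolutionOperator ν p l T) :
    IsConvolutionOperator ν p (integratedForm ν (leftRegular ν ℂ ℂ 1)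
        (continuous_leftRegular ENNReal.one_ne_top) bounded_leftRegular k hk
        ((memLp_one_iff_integrable.2 hl).toLp l)) (S * T) := by
  have h : S * T = integratedForm ν (leftRegular ν ℂ ℂ p) (continuous_leftRegular hp)
      bounded_leftRegular _ (L1.integrable_coeFn (integratedForm ν (leftRegular ν ℂ ℂ 1)
        (continuous_leftRegular ENNReal.one_ne_top) bounded_leftRegular k hk
        ((memLp_one_iff_integrable.2 hl).toLp l))) := by
    ext1 g
    rw [integratedForm_convolution hk hl, ← hS.eq_integratedForm hp hk,
      ← hT.eq_integratedForm hp hl, mul_apply_eq_comp]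
  rw [h]
  exact isConvolutionOperator_integratedForm hp _

variable {Ω : Type*} [MeasurableSpace Ω] {μ : Measure Ω}
    {π : G →* (Lp ℂ p μ →L[ℂ] Lp ℂ p μ)} {B : ℝ}

/-- The integrated form of `π` depends on `k` only through the operator of convolution by `k`: this
is transference for `1 × 1` matrices, applied to a difference with vanishing convolution operator. -/
theorem IsConvolutionOperator.integratedForm_eq (hG : IsAmenableGroup G) (hp : p ≠ ∞)
    (hc : ∀ f, Continuous fun x => π x f) (hB : ∀ x, ‖π x‖ ≤ B) {k l : G → ℂ} (hk : Integrable k ν)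
    (hl : Integrable l ν) {T : Lp ℂ p ν →L[ℂ] Lp ℂ p ν} (hkT : IsConvolutionOperator ν p k T)
    (hlT : IsConvolutionOperator ν p l T) :
    integratedForm ν π hc ⟨B, hB⟩ k hk = integratedForm ν π hc ⟨B, hB⟩ l hl := by
  have hpr : p.toReal ≠ 0 :=
    (ENNReal.toReal_pos (one_pos.trans_le (Fact.out : 1 ≤ p)).ne' hp).ne'
  ext1 f
  rw [← sub_eq_zero, ← integratedForm_sub (hkl := hk.sub hl)]
  have h := sum_norm_integratedForm_rpow_le hG hp hc hB (n := 1) (k := fun _ _ => k - l)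
    (fun _ _ => hk.sub hl) (N := 0) le_rfl (fun g => by
      simp [integratedForm_sub (hk := hk) (hl := hl), ← hkT.eq_integratedForm hp hk,
        ← hlT.eq_integratedForm hp hl, hpr]) fun _ => f
  simp only [Finset.univ_unique, Finset.sum_singleton, mul_zero, zero_mul] at h
  exact norm_eq_zero.1 ((Real.rpow_eq_zero (norm_nonneg _) hpr).1
    (h.antisymm (by positivity)))

theorem exists_linearMap_convolutionOperators (ν : Measure G) [IsHaarMeasure ν] [Regular ν]
    (hG : IsAmenableGroup G) (hp : p ≠ ∞) (hc : ∀ f, Continuous fun x => π x f)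
    (hB : ∀ x, ‖π x‖ ≤ B) :
    ∃ u : convolutionOperators ν p →ₗ[ℂ] (Lp ℂ p μ →L[ℂ] Lp ℂ p μ),
      ∀ (T : convolutionOperators ν p) (k : G → ℂ) (hk : Integrable k ν),
        IsConvolutionOperator ν p k (T : Lp ℂ p ν →L[ℂ] Lp ℂ p ν) →
          u T = integratedForm ν π hc ⟨B, hB⟩ k hk := by
  choose κ hκ hκT using fun T : convolutionOperators ν p => T.2
  refine ⟨{ toFun := fun T => integratedForm ν π hc ⟨B, hB⟩ (κ T) (hκ T)
            map_add' := fun S T => ?_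
            map_smul' := fun c T => ?_ }, fun T k hk hT => ?_⟩
  · rw [← integratedForm_add (hkl := (hκ S).add (hκ T))]
    exact (hκT (S + T)).integratedForm_eq hG hp hc hB _ _ ((hκT S).add hp (hκ S) (hκ T) (hκT T))
  · rw [RingHom.id_apply, ← integratedForm_smul (hck := (hκ T).smul c)]
    exact (hκT (c • T)).integratedForm_eq hG hp hc hB _ _ ((hκT T).const_smul hp c (hκ T))
  · exact (hκT T).integratedForm_eq hG hp hc hB (hκ T) hk hT

theorem pCompletelyBoundedBy_of_eq_integratedForm (hG : IsAmenableGroup G) (hp : p ≠ ∞)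
    (hc : ∀ f, Continuous fun x => π x f) (hB : ∀ x, ‖π x‖ ≤ B)
    {u : convolutionOperators ν p →ₗ[ℂ] (Lp ℂ p μ →L[ℂ] Lp ℂ p μ)}
    (hu : ∀ (T : convolutionOperators ν p) (k : G → ℂ) (hk : Integrable k ν),
      IsConvolutionOperator ν p k (T : Lp ℂ p ν →L[ℂ] Lp ℂ p ν) →
        u T = integratedForm ν π hc ⟨B, hB⟩ k hk) :
    PCompletelyBoundedBy p u (B ^ 2) := by
  intro n m
  have hB0 : 0 ≤ B := (norm_nonneg _).trans (hB 1)
  choose k hk hkm using fun i j => (m i j).2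
  set M := matrixNorm p (m.map fun a => (a : Lp ℂ p ν →L[ℂ] Lp ℂ p ν)) with hM
  have hM0 : 0 ≤ M := matrixNorm_nonneg _
  refine matrixNorm_le hp (by positivity) fun f => ?_
  have h := sum_norm_integratedForm_rpow_le hG hp hc hB hk (N := M ^ p.toReal) (by positivity)
    (fun g => by
      refine le_trans (le_of_eq ?_) (sum_norm_rpow_le_matrixNorm hp
        (m.map fun a => (a : Lp ℂ p ν →L[ℂ] Lp ℂ p ν)) g)
      simp only [Matrix.map_apply, ← (hkm _ _).eq_integratedForm hp (hk _ _)]) f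
  simp only [Matrix.map_apply, hu _ _ (hk _ _) (hkm _ _)]
  rwa [Real.mul_rpow (by positivity) hM0, ← Real.rpow_pow_comm hB0]

end Homomorphism

theorem mainTheorem3 {G : Type*} [TopologicalSpace G] [Group G] [IsTopologicalGroup G]
    [LocallyCompactSpace G] [T2Space G] [MeasurableSpace G] [BorelSpace G]
    (hG : IsAmenableGroup G)
    (ν : Measure G) [IsHaarMeasure ν] [Regular ν]
    {Ω : Type*} [MeasurableSpace Ω] (μ : Measure Ω)
    (p : ℝ≥0∞) [Fact (1 ≤ p)] (hp : p ≠ ∞)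
    (π : G →* (Lp ℂ p μ →L[ℂ] Lp ℂ p μ))
    (hπ_cont : ∀ f : Lp ℂ p μ, Continuous fun x => π x f)
    (hπ_bdd : ∃ B : ℝ, ∀ x, ‖π x‖ ≤ B) :
    (∀ k : G → ℂ, Integrable k ν →
      ∃! T : Lp ℂ p ν →L[ℂ] Lp ℂ p ν, IsConvolutionOperator ν p k T) ∧
    ∃ u : convolutionOperators ν p →ₗ[ℂ] (Lp ℂ p μ →L[ℂ] Lp ℂ p μ),
      (∀ (k : G → ℂ) (hk : Integrable k ν) (T : Lp ℂ p ν →L[ℂ] Lp ℂ p ν)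
        (hT : IsConvolutionOperator ν p k T) (f : Lp ℂ p μ),
          Integrable (fun x => k x • π x f) ν ∧
            u ⟨T, k, hk, hT⟩ f = ∫ x, k x • π x f ∂ν) ∧
      (∀ S T : convolutionOperators ν p,
        ∃ h : (S : Lp ℂ p ν →L[ℂ] Lp ℂ p ν) * T ∈ convolutionOperators ν p,
          u ⟨(S : Lp ℂ p ν →L[ℂ] Lp ℂ p ν) * T, h⟩ = u S * u T) ∧
      IsPCompletelyBounded p u ∧
      pcbNorm p u ≤ (⨆ x, ‖π x‖) ^ 2 := by
  obtain ⟨C, hC⟩ := hπ_bdd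
  have hB : ∀ x, ‖π x‖ ≤ ⨆ x, ‖π x‖ := le_ciSup ⟨C, by rintro _ ⟨x, rfl⟩; exact hC x⟩
  obtain ⟨u, hu⟩ := exists_linearMap_convolutionOperators ν hG hp hπ_cont hB
  have hcb := pCompletelyBoundedBy_of_eq_integratedForm hG hp hπ_cont hB hu
  have hcb' : PCompletelyBoundedBy p u ((⨆ x, ‖π x‖) ^ 2 + 1) := fun n m =>
    (hcb n m).trans (mul_le_mul_of_nonneg_right (le_add_of_nonneg_right zero_le_one)
      (matrixNorm_nonneg _))
  refine ⟨fun k hk => ⟨_, isConvolutionOperator_integratedForm hp hk, fun T hT =>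
    hT.eq_integratedForm hp hk⟩, u, fun k hk T hT f => ?_, fun S T => ?_,
    ⟨(⨆ x, ‖π x‖) ^ 2 + 1, by positivity, hcb'⟩,
    csInf_le ⟨0, fun _ h => h.1⟩ ⟨by positivity, hcb⟩⟩
  · refine ⟨integrable_smul_rep (π := π) hk hπ_cont ⟨C, hC⟩ f, ?_⟩
    rw [hu ⟨T, k, hk, hT⟩ k hk hT, integratedForm_apply]
  · obtain ⟨k, hk, hS⟩ := S.2
    obtain ⟨l, hl, hT⟩ := T.2
    let m := integratedForm ν (leftRegular ν ℂ ℂ 1) (continuous_leftRegular ENNReal.one_ne_top)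
      bounded_leftRegular k hk ((memLp_one_iff_integrable.2 hl).toLp l)
    have hm : Integrable m ν := L1.integrable_coeFn m
    have hST : IsConvolutionOperator ν p m (S * T : Lp ℂ p ν →L[ℂ] Lp ℂ p ν) :=
      hS.mul hp hk hl hT
    refine ⟨⟨m, hm, hST⟩, ?_⟩
    rw [hu ⟨_, m, hm, hST⟩ m hm hST, hu S k hk hS, hu T l hl hT]
    ext1 f
    exact integratedForm_convolution hk hl f
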